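/- **Setting.** Let $\mathcal X$ be a finite set with at least two elements, let $Q$ be (the transition matrix or generator of) an irreducible proposal chain on $\mathcal X$ that is reversible with respect to a probability measure $\mu$, let $\mathcal H:\mathcal X\to\mathbb R$, and write $\mathcal H_{min}=\min\mathcal H$, $M=\max\mathcal H-\min\mathcal H$. Let $\min\mathcal H\le c\le\max\mathcal H$, and let $f:[0,\infty)\to[0,\infty)$ be differentiable and non-decreasing with $f(0)=0$ and $f(u)>0$ for $u>0$. For $\beta=1/\epsilon>0$ put $$\mathcal H^f_{\epsilon,c}(x)=\int_{\mathcal H_{min}}^{\mathcal H(x)}\frac{du}{f((u-c)_+)+\epsilon},\qquad \pi^f_{\epsilon,c}(x)\propto e^{-\mathcal H^f_{\epsilon,c}(x)}\mu(x),$$ $$M^f_{\epsilon,c}(x,y)=Q(x,y)\,e^{-(\mathcal H^f_{\epsilon,c}(y)-\mathcal H^f_{\epsilon,c}(x))_+}\ (x\ne y),\qquad M^f_{\epsilon,c}(x,x)=-\sum_{z\ne x}M^f_{\epsilon,c}(x,z),$$ with the convention $\mathcal H^f_{\infty,c}=0$. A path from $x$ to $y$ is a sequence $x=x_0,\dots,x_n=y$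 ($n\ge 0$) with $Q(x_{i-1},x_i)>0$. Let $G^0(x,y)$ and $G^f_{\epsilon,c}(x,y)$ be the minimum over paths from $x$ to $y$ of the maximum along the path of $\mathcal H$ and of $\mathcal H^f_{\epsilon,c}$ respectively, and $$H^f_{\epsilon,c}=\max_{x,y}\{G^f_{\epsilon,c}(x,y)-\mathcal H^f_{\epsilon,c}(x)-\mathcal H^f_{\epsilon,c}(y)\},$$ $$c^*=\max_{x,y}\{G^0(x,y)\wedge c-\mathcal H(x)\wedge c-\mathcal H(y)\wedge c+\min\mathcal H\}.$$ Let $\lambda_2(-M^f_{\epsilon,c})$ be the spectral gap of $M^f_{\epsilon,c}$ in $\ell^2(\pi^f_{\epsilon,c})$. Call $C_2>0$ a gap constant for $(Q,\mu,\mathcal H,f,c)$ if $C_2e^{-H^f_{\epsilon,c}}\le\lambda_2(-M^f_{\epsilon,c})$ for all $\epsilon>0$. **Theorem.** (i) There is a $C_2>0$ depending only on $\mathcal X$ and $Q$ (with $\mu$) which is a gap constant for all $\mathcal H,f,c$ as above. (ii) Let $\mathcal H,f,c$ be as above, let $C_2$ be any gap constant for them, let $\max\mathcal H-c<\epsilon<M+\max\mathcal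 H-c$, and consider the cooling schedule $$\epsilon_t=\frac{c^*+\epsilon}{\ln(t+1)},\qquad \beta_t=1/\epsilon_t .$$ Put $S_{min}=\arg\min\mathcal H$, $\underline d=\min\{\mathcal H(x):\mathcal H(x)\ne\mathcal H_{min}\}$, $\delta=\min\{\mathcal H(x)-c:\mathcal H(x)>c\}$, $$p=\frac{2M}{M+\max\mathcal H-\epsilon-c}>2,\qquad \overline\epsilon=\frac{p-2}{p},\qquad B=\frac{6M}{c^*+\epsilon},$$ $$A=\frac{1}{C_2(\min_x\mu(x))^{(p-2)/p}}\times\begin{cases}\exp\{M/f(\delta)\},&c<\max\mathcal H,\\1,&c=\max\mathcal H,\end{cases}\qquad K=\frac{4(1+2AB)}{1-\exp\{-\frac1{2A}-B\}}.$$ Let $X^f=(X^f(t))_{t\ge0}$ be a time-inhomogeneous continuous-time Markov chain with generator $M^f_{\epsilon_t,c}$ at time $t$, and $\tau^f_{S_{min}}=\inf\{t\ge0:X^f(t)\in S_{min}\}$. Then for every $x\in\mathcal X\setminus S_{min}$ and every $t\ge e^{1/\overline\epsilon}-1$, $$\mathbb P_x\big(\tau^f_{S_{min}}>t\big)\le\big(1+K^{\frac1{2\overline\epsilon}}\big)\sqrt{\pi^f_{\epsilon_t,c}(\mathcal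 X\setminus S_{min})}+\pi^f_{\epsilon_t,c}(\mathcal X\setminus S_{min}),$$ and the right-hand side tends to $0$ as $t\to\infty$. Moreover, for all $t>0$, $$\pi^f_{\epsilon_t,c}(\mathcal X\setminus S_{min})\le\begin{cases}\dfrac1{\mu(S_{min})}e^{-\beta_t(\underline d-\mathcal H_{min})},&c\ge\underline d,\\[2mm]\dfrac1{\mu(S_{min})}\exp\Big\{-\displaystyle\int_c^{\underline d}\frac{du}{f(u-c)+\epsilon_t}\Big\},&\mathcal H_{min}\le c<\underline d.\end{cases}$$ -/

import Mathlib

open MeasureTheory Filter Topology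
open scoped NNReal

noncomputable section

namespace LandSA

variable {X : Type*}

/-! ### Paths, communication heights, and extreme values on the finite state space -/

/-- `γ 0, …, γ n` is a path from `x` to `y` for the proposal `Q`: every step has positive rate.
The path of length `n = 0` from `x` to `x` is allowed. -/
def IsPath (Q : Matrix X X ℝ) (x y : X) (n : ℕ) (γ : Fin (n + 1) → X) : Prop :=
  γ 0 = x ∧ γ (Fin.last n) = y ∧ ∀ i : Fin n, 0 < Q (γ i.castSucc) (γ i.succ)

/-- The elevation of a path: the highest value of `U` along it. -/
def elev (U : X → ℝ) {n : ℕ} (γ : Fin (n + 1) → X) : ℝ := ⨆ i, U (γ i)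

/-- `G(x, y)`: the lowest elevation of a path from `x` to `y`. -/
def commHeight (Q : Matrix X X ℝ) (U : X → ℝ) (x y : X) : ℝ :=
  sInf {a | ∃ (n : ℕ) (γ : Fin (n + 1) → X), IsPath Q x y n γ ∧ a = elev U γ}

/-- `min H`. -/
def minH (H : X → ℝ) : ℝ := ⨅ x, H x

/-- `max H`. -/
def maxH (H : X → ℝ) : ℝ := ⨆ x, H x

/-- `M = max H - min H`. -/
def osc (H : X → ℝ) : ℝ := maxH H - minH H

/-- The set of global minimisers of `H`. -/
def argminSet (H : X → ℝ) : Set X := {x | H x = minH H}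

/-- The second lowest value of `H`, `min {H x | H x ≠ min H}`. -/
def secondMin (H : X → ℝ) : ℝ := sInf (H '' {x | H x ≠ minH H})

/-- `δ = min {H x - c | H x > c}`. -/
def gapAbove (H : X → ℝ) (c : ℝ) : ℝ := sInf ((fun x => H x - c) '' {x | c < H x})

/-- The clipped critical height
`c* = max_{x,y} (G⁰(x,y) ∧ c - H(x) ∧ c - H(y) ∧ c + min H)`. -/
def clippedHeight (Q : Matrix X X ℝ) (H : X → ℝ) (c : ℝ) : ℝ :=
  ⨆ z : X × X, (min (commHeight Q H z.1 z.2) c - min (H z.1) c - min (H z.2) c + minH H)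

/-! ### Data: proposal chain, modification function -/

/-- `Q` is an irreducible proposal chain, reversible with respect to the probability vector `μ`.
Only the off-diagonal entries of `Q` enter the dynamics, so `Q` may be a transition matrix or
an infinitesimal generator; the diagonal is left unconstrained. -/
structure IsProposal [Fintype X] (Q : Matrix X X ℝ) (μ : X → ℝ) : Prop where
  rate_nonneg : ∀ x y, x ≠ y → 0 ≤ Q x y
  irreducible : ∀ x y, ∃ (n : ℕ) (γ : Fin (n + 1) → X), IsPath Q x y n γ
  prob_nonneg : ∀ x, 0 ≤ μ x
  prob_sum : ∑ x, μ x = 1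
  reversible : ∀ x y, μ x * Q x y = μ y * Q y x

/-- `f : [0,∞) → [0,∞)` is differentiable and non-decreasing with `f 0 = 0`,
and positive on `(0,∞)`. Values of `f` on `(-∞,0)` are never used. -/
structure IsModFun (f : ℝ → ℝ) : Prop where
  nonneg : ∀ u, 0 ≤ u → 0 ≤ f u
  differentiable : DifferentiableOn ℝ f (Set.Ici 0)
  mono : MonotoneOn f (Set.Ici 0)
  zero : f 0 = 0
  pos : ∀ u, 0 < u → 0 < f u

/-! ### Metropolis-Hastings with landscape modification, at inverse temperature `β = 1/ε` -/

/-- The modified Hamiltonian `∫_{min H}^{H x} du / (f((u-c)₊) + ε)` at temperature `ε = 1/β`,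
written as `∫ β / (β f((u-c)₊) + 1) du` so that infinite temperature `β = 0` is included
(there it vanishes). -/
def modH (H : X → ℝ) (f : ℝ → ℝ) (c β : ℝ) (x : X) : ℝ :=
  ∫ u in (minH H)..(H x), β / (β * f (max (u - c) 0) + 1)

theorem modH_eq (H : X → ℝ) (f : ℝ → ℝ) (c : ℝ) {ε : ℝ} (hε : 0 < ε) (x : X) :
    modH H f c (1 / ε) x = ∫ u in (minH H)..(H x), 1 / (f (max (u - c) 0) + ε) := by
  unfold modH
  congr 1
  funext u
  have h : 1 / ε * f (max (u - c) 0) + 1 = (f (max (u - c) 0) + ε) / ε := by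
    field_simp
  rw [h, div_div_div_cancel_right₀ hε.ne']

theorem modH_zero (H : X → ℝ) (f : ℝ → ℝ) (c : ℝ) (x : X) : modH H f c 0 x = 0 := by
  simp [modH]

/-- The Gibbs distribution `π(x) ∝ exp(-modH x) μ(x)`. -/
def gibbs [Fintype X] (μ H : X → ℝ) (f : ℝ → ℝ) (c β : ℝ) (x : X) : ℝ :=
  Real.exp (-modH H f c β x) * μ x / ∑ y, Real.exp (-modH H f c β y) * μ y

/-- The off-diagonal rates `Q(x,y) exp(-(modH y - modH x)₊)`. -/
def rate (Q : Matrix X X ℝ) (H : X → ℝ) (f : ℝ → ℝ) (c β : ℝ) (x y : X) : ℝ :=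
  Q x y * Real.exp (-max (modH H f c β y - modH H f c β x) 0)

open Classical in
/-- The infinitesimal generator of the landscape-modified Metropolis-Hastings chain. -/
def gen [Fintype X] (Q : Matrix X X ℝ) (H : X → ℝ) (f : ℝ → ℝ) (c β : ℝ) : Matrix X X ℝ :=
  fun x y => if x = y then -∑ z ∈ Finset.univ.erase x, rate Q H f c β x z
    else rate Q H f c β x y

/-- `⟨g, h⟩_π`. -/
def wInner [Fintype X] (π g h : X → ℝ) : ℝ := ∑ x, g x * h x * π x

/-- The spectral gap `λ₂(-L)` in `ℓ²(π)`: the infimum of the Rayleigh quotients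
of nonzero functions of mean zero. -/
def spectralGap [Fintype X] (π : X → ℝ) (L : Matrix X X ℝ) : ℝ :=
  sInf {r | ∃ l : X → ℝ, l ≠ 0 ∧ ∑ x, π x * l x = 0 ∧
    r = wInner π (-(L.mulVec l)) l / wInner π l l}

/-- The critical height `max_{x,y} (G(x,y) - modH x - modH y)` of the modified landscape. -/
def modHeight (Q : Matrix X X ℝ) (H : X → ℝ) (f : ℝ → ℝ) (c β : ℝ) : ℝ :=
  ⨆ z : X × X, (commHeight Q (modH H f c β) z.1 z.2 - modH H f c β z.1 - modH H f c β z.2)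

/-- `C₂ > 0` is a constant in the low-temperature lower bound on the spectral gap:
`C₂ exp(-H^f_{ε,c}) ≤ λ₂(-M^f_{ε,c})` at every temperature. -/
def IsGapConst [Fintype X] (Q : Matrix X X ℝ) (μ H : X → ℝ) (f : ℝ → ℝ) (c C₂ : ℝ) : Prop :=
  0 < C₂ ∧ ∀ β : ℝ, 0 < β →
    C₂ * Real.exp (-modHeight Q H f c β) ≤ spectralGap (gibbs μ H f c β) (gen Q H f c β)

/-! ### The cooling schedule and the constants of the bound -/

/-- `ε_t = (c* + ε) / ln(t+1)`, for `t > 0`. -/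
def temp (Q : Matrix X X ℝ) (H : X → ℝ) (c ε t : ℝ) : ℝ :=
  (clippedHeight Q H c + ε) / Real.log (t + 1)

/-- `β_t = 1/ε_t = ln(t+1) / (c* + ε)`, for `t ≥ 0`; thus `β_0 = 0`. -/
def invTemp (Q : Matrix X X ℝ) (H : X → ℝ) (c ε t : ℝ) : ℝ :=
  Real.log (t + 1) / (clippedHeight Q H c + ε)

theorem invTemp_eq (Q : Matrix X X ℝ) (H : X → ℝ) (c ε t : ℝ) :
    invTemp Q H c ε t = 1 / temp Q H c ε t := by
  simp [invTemp, temp]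

/-- `p = 2M / (M + max H - ε - c)`. -/
def pExp (H : X → ℝ) (c ε : ℝ) : ℝ := 2 * osc H / (osc H + maxH H - ε - c)

/-- `ε̄ = (p - 2) / p`. -/
def epsBar (H : X → ℝ) (c ε : ℝ) : ℝ := (pExp H c ε - 2) / pExp H c ε

open Classical in
/-- The constant `A`. -/
def constA (μ H : X → ℝ) (f : ℝ → ℝ) (c ε C₂ : ℝ) : ℝ :=
  if c < maxH H then
    1 / (C₂ * (⨅ x, μ x) ^ ((pExp H c ε - 2) / pExp H c ε)) *
      Real.exp (1 / f (gapAbove H c) * osc H)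
  else 1 / (C₂ * (⨅ x, μ x) ^ ((pExp H c ε - 2) / pExp H c ε))

/-- The constant `B = 6M / (c* + ε)`. -/
def constB (Q : Matrix X X ℝ) (H : X → ℝ) (c ε : ℝ) : ℝ :=
  6 * osc H / (clippedHeight Q H c + ε)

/-- `K = 4(1 + 2AB) / (1 - exp(-1/(2A) - B))`. -/
def constK (A B : ℝ) : ℝ := 4 * (1 + 2 * A * B) / (1 - Real.exp (-(1 / (2 * A)) - B))

/-- The total mass `ν(S)` of a set under a weight `ν`. -/
def mass [Fintype X] (ν : X → ℝ) (S : Set X) : ℝ := ∑ x, S.indicator ν x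

/-- `π_t(X ∖ S_min)`, with `π_t` the Gibbs distribution at temperature `ε_t`. -/
def offMin [Fintype X] (Q : Matrix X X ℝ) (μ H : X → ℝ) (f : ℝ → ℝ) (c ε t : ℝ) : ℝ :=
  mass (gibbs μ H f c (invTemp Q H c ε t)) (argminSet H)ᶜ

/-- The bound `(1 + K^{1/(2ε̄)}) √(π_t(X ∖ S_min)) + π_t(X ∖ S_min)`. -/
def hitBound [Fintype X] (Q : Matrix X X ℝ) (μ H : X → ℝ) (f : ℝ → ℝ) (c ε C₂ t : ℝ) : ℝ :=
  (1 + constK (constA μ H f c ε C₂) (constB Q H c ε) ^ (1 / (2 * epsBar H c ε))) *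
      Real.sqrt (offMin Q μ H f c ε t) + offMin Q μ H f c ε t

/-! ### Time-inhomogeneous continuous-time Markov chains on a finite state space -/

/-- `T s t` (`0 ≤ s ≤ t`) are the transition matrices generated by the time-dependent generator
`L`: they solve the Kolmogorov forward equation `∂ₜ T s t = T s t * L t`, `T s s = 1`. -/
def IsTransitionFamily [Fintype X] (L : ℝ → Matrix X X ℝ) (T : ℝ → ℝ → Matrix X X ℝ) : Prop :=
  ∀ s, 0 ≤ s →
    (∀ x, T s s x x = 1) ∧ (∀ x y, x ≠ y → T s s x y = 0) ∧
    ∀ t, s ≤ t → ∀ x y,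
      HasDerivWithinAt (fun r => T s r x y) ((T s t * L t) x y) (Set.Ici s) t

/-- `Y` is, under `P`, a continuous-time Markov chain started at `x` with time-dependent
generator `L`: right-continuous paths with left limits, and the Markov property with respect to
its own history, with the transition matrices generated by `L`. -/
structure IsMarkovChain [Fintype X] {Ω : Type*} [MeasurableSpace Ω] (P : Measure Ω)
    (L : ℝ → Matrix X X ℝ) (x : X) (Y : ℝ≥0 → Ω → X) : Prop where
  measurable : ∀ t y, MeasurableSet {ω | Y t ω = y}
  start : ∀ᵐ ω ∂P, Y 0 ω = x
  rightCont : ∀ ω t, ∀ᶠ r in 𝓝[>] t, Y r ω = Y t ω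
  leftLim : ∀ ω t, ∃ y, ∀ᶠ r in 𝓝[<] t, Y r ω = y
  markov : ∃ T : ℝ → ℝ → Matrix X X ℝ, IsTransitionFamily L T ∧
    ∀ s t : ℝ≥0, s ≤ t → ∀ E : Set Ω,
      MeasurableSet[MeasurableSpace.generateFrom
        {F | ∃ r ≤ s, ∃ y, F = {ω | Y r ω = y}}] E →
      ∀ y z, P.real (E ∩ {ω | Y s ω = y} ∩ {ω | Y t ω = z}) =
        P.real (E ∩ {ω | Y s ω = y}) * T s t y z

end LandSA

end

open LandSA

namespace LandSA

variable {X : Type*}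

/-! Let `ρ_t` be the law of the chain, `π_t` the Gibbs law at temperature `ε_t`, and `N = Σ
ρ_t²/π_t`. If the chain has not hit the minimisers by time `t`, it is off them at time `t`;
Cauchy–Schwarz (`sum_indicator_le`) bounds that probability by `√N √π_t(X ∖ S_min)`. So it suffices
to bound `N` uniformly for large `t`.

The derivative of `N` has two parts (`hasDerivAt_densitySq`): the motion of `π_t` contributes at
most `M/(c*+ε)/(1+t) · N`, and relaxation contributes at most `-2 gap (N-1)`. Above `c` the modified
landscape costs at most `β (max H - c)`, so its critical height is at most `β (c* + max H - c)`
(`modHeight_le`). Along the schedule the gap is therefore at least a constant times `exp(β M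
ε̄)/(1+t)`, while `1/π_t` is at most a constant times `exp(β M)`. Since `N ≤ max 1/π_t`, this gives
`N^ε̄ ≤ A (1+t) gap` (`gibbs_rpow_le_gap`, `densitySq_rpow_le`). The result is a Bernoulli
differential inequality with damping `N^(1+ε̄)`, whose solutions are bounded independently of `N 0`
(`rpow_le_of_bernoulli`).

The uniform gap constant comes from a path argument (`gibbs_mul_sq_sub_le`). The Gibbs mass off the
minimisers vanishes because the barrier above `c` diverges as `ε_t → 0`, `f` being at most linear
near `0` (`tendsto_integral_atTop`). -/

theorem IsProposal.mu_pos [Fintype X] {Q : Matrix X X ℝ} {μ : X → ℝ} (hQ : IsProposal Q μ)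
    (x : X) : 0 < μ x := by
  obtain ⟨x₀, hx₀⟩ : ∃ x₀, 0 < μ x₀ := by
    by_contra! h
    have := Finset.sum_nonpos (fun x (_ : x ∈ Finset.univ) => h x)
    rw [hQ.prob_sum] at this
    linarith
  -- By reversibility `μ b = 0` would force `μ a * Q a b = 0`, so positivity spreads along paths.
  have step : ∀ a b, 0 < μ a → 0 < Q a b → 0 < μ b := by
    intro a b ha hab
    refine (hQ.prob_nonneg b).lt_of_ne' fun hb => ?_
    have := hQ.reversible a b
    rw [hb, zero_mul] at this
    exact absurd this (mul_pos ha hab).ne'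
  obtain ⟨n, γ, h0, hn, hs⟩ := hQ.irreducible x₀ x
  have key : ∀ i : Fin (n + 1), 0 < μ (γ i) := by
    intro i
    induction i using Fin.induction with
    | zero => rwa [h0]
    | succ i ih => exact step _ _ ih (hs i)
  exact hn ▸ key _

/-! ### Extreme values on a finite space. -/

section Extremes

variable [Finite X]

theorem minH_le (H : X → ℝ) (x : X) : minH H ≤ H x :=
  ciInf_le (Set.finite_range H).bddBelow x

theorem le_maxH (H : X → ℝ) (x : X) : H x ≤ maxH H :=
  le_ciSup (Set.finite_range H).bddAbove x

theorem exists_eq_minH [Nonempty X] (H : X → ℝ) : ∃ x, H x = minH H :=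
  exists_eq_ciInf_of_finite

end Extremes

/-! ### The integrand of the modified Hamiltonian -/

section Integrand

variable {f : ℝ → ℝ} {c β : ℝ}

theorem IsModFun.continuous_clip (hf : IsModFun f) (c : ℝ) :
    Continuous fun u => f (max (u - c) 0) :=
  hf.differentiable.continuousOn.comp_continuous (by fun_prop) fun _ => Set.mem_Ici.2 (le_max_right _ _)

theorem IsModFun.clip_nonneg (hf : IsModFun f) (c u : ℝ) : 0 ≤ f (max (u - c) 0) :=
  hf.nonneg _ (le_max_right _ _)

theorem one_le_denom (hf : IsModFun f) (hβ : 0 ≤ β) (u : ℝ) :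
    1 ≤ β * f (max (u - c) 0) + 1 := by
  have := mul_nonneg hβ (hf.clip_nonneg c u)
  linarith

theorem continuous_integrand (hf : IsModFun f) (hβ : 0 ≤ β) :
    Continuous fun u => β / (β * f (max (u - c) 0) + 1) := by
  have := hf.continuous_clip c
  exact continuous_const.div ((continuous_const.mul this).add continuous_const) fun u => by linarith [one_le_denom (c := c) hf hβ u]

theorem integrand_nonneg (hf : IsModFun f) (hβ : 0 ≤ β) (u : ℝ) :
    0 ≤ β / (β * f (max (u - c) 0) + 1) :=
  div_nonneg hβ (by linarith [one_le_denom (c := c) hf hβ u])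

theorem integrand_le (hf : IsModFun f) (hβ : 0 ≤ β) (u : ℝ) :
    β / (β * f (max (u - c) 0) + 1) ≤ β :=
  div_le_self hβ (one_le_denom hf hβ u)

theorem integrand_of_le (hf : IsModFun f) {u : ℝ} (hu : u ≤ c) :
    β / (β * f (max (u - c) 0) + 1) = β := by
  rw [max_eq_right (by linarith), hf.zero]
  simp

theorem integral_integrand_of_le (hf : IsModFun f) {a b : ℝ} (hab : a ≤ b) (hb : b ≤ c) :
    ∫ u in a..b, β / (β * f (max (u - c) 0) + 1) = β * (b - a) := by
  rw [intervalIntegral.integral_congr (g := fun _ => β)]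
  · simp [mul_comm]
  · intro u hu
    rw [Set.uIcc_of_le hab] at hu
    exact integrand_of_le hf (hu.2.trans hb)

theorem integral_integrand_le (hf : IsModFun f) (hβ : 0 ≤ β) {a b : ℝ} (hab : a ≤ b) :
    ∫ u in a..b, β / (β * f (max (u - c) 0) + 1) ≤ β * (b - a) := by
  have h : ∫ u in a..b, β / (β * f (max (u - c) 0) + 1) ≤ ∫ _ in a..b, β :=
    intervalIntegral.integral_mono_on hab ((continuous_integrand hf hβ).intervalIntegrable _ _)
      intervalIntegrable_const fun u _ => integrand_le hf hβ u
  simpa [mul_comm] using h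

theorem integral_integrand_nonneg (hf : IsModFun f) (hβ : 0 ≤ β) {a b : ℝ} (hab : a ≤ b) :
    0 ≤ ∫ u in a..b, β / (β * f (max (u - c) 0) + 1) :=
  intervalIntegral.integral_nonneg hab fun u _ => integrand_nonneg hf hβ u

theorem integral_integrand_add (hf : IsModFun f) (hβ : 0 ≤ β) (a b d : ℝ) :
    (∫ u in a..b, β / (β * f (max (u - c) 0) + 1)) +
      ∫ u in b..d, β / (β * f (max (u - c) 0) + 1) =
      ∫ u in a..d, β / (β * f (max (u - c) 0) + 1) :=
  intervalIntegral.integral_add_adjacent_intervals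
    ((continuous_integrand hf hβ).intervalIntegrable _ _)
    ((continuous_integrand hf hβ).intervalIntegrable _ _)

end Integrand

/-! ### Bounds on the modified Hamiltonian -/

section ModH

variable {H : X → ℝ} {f : ℝ → ℝ} {c β : ℝ}

theorem modH_of_eq_minH {x : X} (hx : H x = minH H) : modH H f c β x = 0 := by
  simp [modH, hx]

theorem integral_le_modH (hf : IsModFun f) (hβ : 0 ≤ β) {x : X} {h : ℝ} (hx : h ≤ H x) :
    ∫ u in (minH H)..h, β / (β * f (max (u - c) 0) + 1) ≤ modH H f c β x := by
  unfold modH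
  rw [← integral_integrand_add hf hβ (minH H) h (H x)]
  linarith [integral_integrand_nonneg (c := c) hf hβ hx]

variable [Finite X]

theorem modH_nonneg (hf : IsModFun f) (hβ : 0 ≤ β) (x : X) : 0 ≤ modH H f c β x :=
  integral_integrand_nonneg hf hβ (minH_le H x)

theorem modH_le_mul_osc (hf : IsModFun f) (hβ : 0 ≤ β) (x : X) :
    modH H f c β x ≤ β * osc H :=
  (integral_integrand_le hf hβ (minH_le H x)).trans
    (mul_le_mul_of_nonneg_left (by unfold osc; linarith [le_maxH H x]) hβ)

/-- The integrand equals `β` below `c` and lies in `[0, β]` above it. Hence `modH` is `β` times the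
clipped height, up to an error of at most `β (max H - c)`; this bound and the next are the two
sides. -/
theorem mul_clip_le_modH (hf : IsModFun f) (hβ : 0 ≤ β) (hc : minH H ≤ c) (x : X) :
    β * (min (H x) c - minH H) ≤ modH H f c β x := by
  rw [← integral_integrand_of_le hf (le_min (minH_le H x) hc) (min_le_right _ _)]
  exact integral_le_modH hf hβ (min_le_left _ _)

theorem modH_le_mul_clip_add (hf : IsModFun f) (hβ : 0 ≤ β) (hc : minH H ≤ c)
    (hc' : c ≤ maxH H) (x : X) :
    modH H f c β x ≤ β * (min (H x) c - minH H) + β * (maxH H - c) := by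
  unfold modH
  rw [← integral_integrand_add hf hβ (minH H) (min (H x) c) (H x),
    integral_integrand_of_le hf (le_min (minH_le H x) hc) (min_le_right _ _)]
  refine add_le_add_right ((integral_integrand_le hf hβ (min_le_left _ _)).trans
    (mul_le_mul_of_nonneg_left ?_ hβ)) _
  rcases le_total (H x) c with h | h
  · rw [min_eq_left h]; linarith
  · rw [min_eq_right h]; linarith [le_maxH H x]

end ModH

/-! ### Gibbs weights and the Dirichlet form -/

section Gibbs

variable [Fintype X] {Q : Matrix X X ℝ} {μ H : X → ℝ} {f : ℝ → ℝ} {c β : ℝ}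

/-- The partition function. -/
noncomputable def partFn (μ H : X → ℝ) (f : ℝ → ℝ) (c β : ℝ) : ℝ :=
  ∑ y, Real.exp (-modH H f c β y) * μ y

theorem partFn_pos (hQ : IsProposal Q μ) [Nonempty X] : 0 < partFn μ H f c β :=
  Finset.sum_pos (fun y _ => mul_pos (Real.exp_pos _) (hQ.mu_pos y)) Finset.univ_nonempty

theorem partFn_le_one (hQ : IsProposal Q μ) (hf : IsModFun f) (hβ : 0 ≤ β) :
    partFn μ H f c β ≤ 1 := by
  rw [← hQ.prob_sum]
  refine Finset.sum_le_sum fun y _ => mul_le_of_le_one_left (hQ.prob_nonneg y) ?_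
  exact Real.exp_le_one_iff.2 (neg_nonpos.2 (modH_nonneg hf hβ y))

theorem le_partFn_of_eq_minH (hQ : IsProposal Q μ) {x : X} (hx : H x = minH H) :
    μ x ≤ partFn μ H f c β := by
  have := Finset.single_le_sum (f := fun y => Real.exp (-modH H f c β y) * μ y)
    (fun y _ => mul_nonneg (Real.exp_pos _).le (hQ.prob_nonneg y)) (Finset.mem_univ x)
  simpa [partFn, modH_of_eq_minH hx] using this

theorem gibbs_eq (x : X) :
    gibbs μ H f c β x = Real.exp (-modH H f c β x) * μ x / partFn μ H f c β := rfl

theorem gibbs_pos (hQ : IsProposal Q μ) (x : X) : 0 < gibbs μ H f c β x :=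
  haveI : Nonempty X := ⟨x⟩
  div_pos (mul_pos (Real.exp_pos _) (hQ.mu_pos x)) (partFn_pos hQ)

theorem gibbs_sum (hQ : IsProposal Q μ) [Nonempty X] : ∑ x, gibbs μ H f c β x = 1 := by
  simp only [gibbs_eq, ← Finset.sum_div]
  exact div_self (partFn_pos hQ).ne'

theorem rate_nonneg (hQ : IsProposal Q μ) {x y : X} (h : x ≠ y) : 0 ≤ rate Q H f c β x y :=
  mul_nonneg (hQ.rate_nonneg x y h) (Real.exp_pos _).le

/-- The Metropolis factor turns the weight of `x` into that of the higher endpoint, so the flow is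
symmetric once `μ x * Q x y` is. -/
theorem gibbs_mul_rate (x y : X) :
    gibbs μ H f c β x * rate Q H f c β x y =
      μ x * Q x y * Real.exp (-max (modH H f c β x) (modH H f c β y)) / partFn μ H f c β := by
  have : max (modH H f c β x) (modH H f c β y) =
      modH H f c β x + max (modH H f c β y - modH H f c β x) 0 := by
    rw [← max_add_add_left, max_comm]; simp
  rw [gibbs_eq, rate, this, neg_add, Real.exp_add]
  ring

theorem gibbs_mul_rate_comm (hQ : IsProposal Q μ) (x y : X) :
    gibbs μ H f c β x * rate Q H f c β x y = gibbs μ H f c β y * rate Q H f c β y x := by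
  rw [gibbs_mul_rate, gibbs_mul_rate, hQ.reversible, max_comm]

theorem gen_offDiag {x y : X} (h : x ≠ y) : gen Q H f c β x y = rate Q H f c β x y :=
  if_neg h

theorem gen_diag [DecidableEq X] (x : X) :
    gen Q H f c β x x = -∑ z ∈ Finset.univ.erase x, rate Q H f c β x z := by
  rw [gen, if_pos rfl]
  congr!

/-- The term `y = x` vanishes, so the unconstrained diagonal of `Q` does no harm. -/
theorem gen_mulVec (l : X → ℝ) (x : X) :
    (gen Q H f c β).mulVec l x = ∑ y, rate Q H f c β x y * (l y - l x) := by
  classical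
  rw [← Finset.add_sum_erase _ _ (Finset.mem_univ x), Matrix.mulVec, dotProduct,
    ← Finset.add_sum_erase _ _ (Finset.mem_univ x), gen_diag,
    Finset.sum_congr rfl fun y hy =>
      congrArg (· * l y) (gen_offDiag (Finset.ne_of_mem_erase hy).symm)]
  simp only [sub_self, mul_zero, zero_add, mul_sub, Finset.sum_sub_distrib, ← Finset.sum_mul]
  ring

/-- The Dirichlet form of the modified chain. -/
theorem wInner_neg_gen (hQ : IsProposal Q μ) (l : X → ℝ) :
    wInner (gibbs μ H f c β) (-((gen Q H f c β).mulVec l)) l =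
      1 / 2 * ∑ x, ∑ y, gibbs μ H f c β x * rate Q H f c β x y * (l x - l y) ^ 2 := by
  have h1 : wInner (gibbs μ H f c β) (-((gen Q H f c β).mulVec l)) l =
      ∑ x, ∑ y, gibbs μ H f c β x * rate Q H f c β x y * ((l x - l y) * l x) := by
    unfold wInner
    refine Finset.sum_congr rfl fun x _ => ?_
    rw [Pi.neg_apply, gen_mulVec, ← Finset.sum_neg_distrib, Finset.sum_mul, Finset.sum_mul]
    exact Finset.sum_congr rfl fun y _ => by ring
  have h2 : wInner (gibbs μ H f c β) (-((gen Q H f c β).mulVec l)) l =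
      ∑ x, ∑ y, gibbs μ H f c β x * rate Q H f c β x y * ((l y - l x) * l y) := by
    rw [h1, Finset.sum_comm]
    refine Finset.sum_congr rfl fun x _ => Finset.sum_congr rfl fun y _ => ?_
    rw [gibbs_mul_rate_comm hQ]
  have h3 : ∑ x, ∑ y, gibbs μ H f c β x * rate Q H f c β x y * (l x - l y) ^ 2 =
      (∑ x, ∑ y, gibbs μ H f c β x * rate Q H f c β x y * ((l x - l y) * l x)) +
      ∑ x, ∑ y, gibbs μ H f c β x * rate Q H f c β x y * ((l y - l x) * l y) := by
    simp only [← Finset.sum_add_distrib]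
    exact Finset.sum_congr rfl fun x _ => Finset.sum_congr rfl fun y _ => by ring
  rw [h3, ← h1, ← h2]
  ring

theorem dirichlet_term_nonneg (hQ : IsProposal Q μ) (l : X → ℝ) (x y : X) :
    0 ≤ gibbs μ H f c β x * rate Q H f c β x y * (l x - l y) ^ 2 := by
  rcases eq_or_ne x y with rfl | h
  · simp
  · exact mul_nonneg (mul_nonneg (gibbs_pos hQ x).le (rate_nonneg hQ h)) (sq_nonneg _)

theorem wInner_neg_gen_nonneg (hQ : IsProposal Q μ) (l : X → ℝ) :
    0 ≤ wInner (gibbs μ H f c β) (-((gen Q H f c β).mulVec l)) l := by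
  rw [wInner_neg_gen hQ]
  exact mul_nonneg (by norm_num) (Finset.sum_nonneg fun x _ => Finset.sum_nonneg fun y _ =>
    dirichlet_term_nonneg hQ l x y)

theorem wInner_self_pos (hQ : IsProposal Q μ) {l : X → ℝ} (hl : l ≠ 0) :
    0 < wInner (gibbs μ H f c β) l l := by
  obtain ⟨x, hx⟩ := Function.ne_iff.1 hl
  refine Finset.sum_pos' (fun y _ => mul_nonneg (mul_self_nonneg _) (gibbs_pos hQ y).le)
    ⟨x, Finset.mem_univ x, mul_pos (mul_self_pos.2 hx) (gibbs_pos hQ x)⟩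

theorem spectralGap_mul_le (hQ : IsProposal Q μ) {l : X → ℝ}
    (hl : ∑ x, gibbs μ H f c β x * l x = 0) :
    spectralGap (gibbs μ H f c β) (gen Q H f c β) * wInner (gibbs μ H f c β) l l ≤
      wInner (gibbs μ H f c β) (-((gen Q H f c β).mulVec l)) l := by
  rcases eq_or_ne l 0 with rfl | h0
  · simp [wInner]
  · have hpos := wInner_self_pos (H := H) (f := f) (c := c) (β := β) hQ h0
    rw [← le_div_iff₀ hpos]
    -- The real `sInf` is a lower bound only for sets bounded below; here `0` is a bound.
    refine csInf_le ⟨0, ?_⟩ ⟨l, h0, hl, rfl⟩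
    rintro r ⟨l, h0, -, rfl⟩
    exact div_nonneg (wInner_neg_gen_nonneg hQ l) (wInner_self_pos hQ h0).le

theorem le_spectralGap [Nontrivial X] (hQ : IsProposal Q μ) {a : ℝ}
    (h : ∀ l : X → ℝ, ∑ x, gibbs μ H f c β x * l x = 0 →
      a * wInner (gibbs μ H f c β) l l ≤
        wInner (gibbs μ H f c β) (-((gen Q H f c β).mulVec l)) l) :
    a ≤ spectralGap (gibbs μ H f c β) (gen Q H f c β) := by
  classical
  refine le_csInf ?_ ?_
  · obtain ⟨x, y, hxy⟩ := exists_pair_ne X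
    -- The infimum must not be over the empty set: `δ_x/π(x) - δ_y/π(y)` is nonzero with mean zero.
    refine ⟨_, Pi.single x (gibbs μ H f c β x)⁻¹ - Pi.single y (gibbs μ H f c β y)⁻¹, ?_, ?_, rfl⟩
    · intro h0
      have := congrFun h0 x
      simp [hxy, (gibbs_pos (H := H) (f := f) (c := c) (β := β) hQ x).ne'] at this
    · simp [mul_sub, Finset.sum_sub_distrib, Pi.single_apply,
        (gibbs_pos (H := H) (f := f) (c := c) (β := β) hQ _).ne']
  · rintro r ⟨l, h0, hl, rfl⟩
    rw [le_div_iff₀ (wInner_self_pos hQ h0)]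
    exact h l hl

end Gibbs

/-! ### Communication heights -/

section CommHeight

variable [Finite X] {Q : Matrix X X ℝ} {U : X → ℝ} {x y : X}

/-- Each elevation is a value of `U`, so the infimum over infinitely many paths is attained. -/
theorem finite_elevations (Q : Matrix X X ℝ) (U : X → ℝ) (x y : X) :
    {a | ∃ (n : ℕ) (γ : Fin (n + 1) → X), IsPath Q x y n γ ∧ a = elev U γ}.Finite := by
  refine (Set.finite_range U).subset ?_
  rintro a ⟨n, γ, -, rfl⟩
  obtain ⟨i, hi⟩ := exists_eq_ciSup_of_finite (f := fun i => U (γ i))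
  exact ⟨γ i, hi⟩

theorem exists_path_le_commHeight (U : X → ℝ)
    (h : ∃ (n : ℕ) (γ : Fin (n + 1) → X), IsPath Q x y n γ) :
    ∃ (n : ℕ) (γ : Fin (n + 1) → X), IsPath Q x y n γ ∧ ∀ i, U (γ i) ≤ commHeight Q U x y := by
  obtain ⟨n, γ, hγ⟩ := h
  have hne : {a | ∃ (n : ℕ) (γ : Fin (n + 1) → X), IsPath Q x y n γ ∧ a = elev U γ}.Nonempty :=
    ⟨_, n, γ, hγ, rfl⟩
  obtain ⟨n, γ, hγ, he⟩ := hne.csInf_mem (finite_elevations Q U x y)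
  refine ⟨n, γ, hγ, fun i => ?_⟩
  rw [commHeight, he]
  exact le_ciSup (f := fun i => U (γ i)) (Set.finite_range _).bddAbove i

theorem commHeight_le {n : ℕ} {γ : Fin (n + 1) → X} (hγ : IsPath Q x y n γ) {a : ℝ}
    (ha : ∀ i, U (γ i) ≤ a) : commHeight Q U x y ≤ a :=
  (csInf_le (finite_elevations Q U x y).bddBelow ⟨n, γ, hγ, rfl⟩).trans (ciSup_le ha)

end CommHeight

/-- If a function varies by at most `m` along every step of `Q` below level `a`, then it varies by
at most `m * card X` between two points joined by a path below level `a`. -/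
theorem abs_sub_le_of_isPath [Fintype X] {Q : Matrix X X ℝ} {U l : X → ℝ} {a m : ℝ} (hm : 0 ≤ m)
    (hl : ∀ z w, 0 < Q z w → U z ≤ a → U w ≤ a → |l z - l w| ≤ m)
    {x y : X} {n : ℕ} {γ : Fin (n + 1) → X} (hγ : IsPath Q x y n γ) (ha : ∀ i, U (γ i) ≤ a) :
    |l x - l y| ≤ Fintype.card X * m := by
  classical
  -- An undirected graph on the sublevel set lets loops be erased; a simple path has fewer than
  -- `card X` edges, however long `γ` is.
  let G := SimpleGraph.fromRel fun z w => 0 < Q z w ∧ U z ≤ a ∧ U w ≤ a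
  have hG : ∀ z w, G.Adj z w → |l z - l w| ≤ m := by
    intro z w h
    rcases ((SimpleGraph.fromRel_adj _ _ _).1 h).2 with ⟨h1, h2, h3⟩ | ⟨h1, h2, h3⟩
    · exact hl z w h1 h2 h3
    · rw [abs_sub_comm]; exact hl w z h1 h2 h3
  have hwalk : ∀ {z w : X} (p : G.Walk z w), |l z - l w| ≤ p.length * m := by
    intro z w p
    induction p with
    | nil => simp
    | @cons u v w h p ih =>
      rw [SimpleGraph.Walk.length_cons, Nat.cast_add, Nat.cast_one, add_mul, one_mul]
      calc |l u - l w| ≤ |l u - l v| + |l v - l w| := abs_sub_le _ _ _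
        _ ≤ _ := by linarith [hG u v h]
  have hreach : ∀ i, G.Reachable x (γ i) := by
    intro i
    induction i using Fin.induction with
    | zero => rw [hγ.1]
    | succ i ih =>
      rcases eq_or_ne (γ i.castSucc) (γ i.succ) with h | h
      · rwa [← h]
      · exact ih.trans (SimpleGraph.Adj.reachable ((SimpleGraph.fromRel_adj _ _ _).2
          ⟨h, Or.inl ⟨hγ.2.2 i, ha _, ha _⟩⟩))
  obtain ⟨p⟩ := hγ.2.1 ▸ hreach (Fin.last n)
  refine (hwalk p.toPath.1).trans (mul_le_mul_of_nonneg_right ?_ hm)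
  exact_mod_cast p.toPath.2.length_lt.le

/-! ### A spectral gap bound uniform over landscapes -/

section Gap

variable [Fintype X] {Q : Matrix X X ℝ} {μ : X → ℝ}

theorem exists_pos_le_flow (hQ : IsProposal Q μ) :
    ∃ q : ℝ, 0 < q ∧ ∀ x y, 0 < Q x y → q ≤ μ x * Q x y := by
  classical
  by_cases h : ∃ z : X × X, 0 < Q z.1 z.2
  · obtain ⟨z, hz, hmin⟩ := Set.exists_min_image {z : X × X | 0 < Q z.1 z.2}
      (fun z => μ z.1 * Q z.1 z.2) (Set.toFinite _) h
    exact ⟨_, mul_pos (hQ.mu_pos _) hz, fun x y hxy => hmin (x, y) hxy⟩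
  · exact ⟨1, one_pos, fun x y hxy => absurd ⟨(x, y), hxy⟩ h⟩

theorem exists_pos_le_mu (hQ : IsProposal Q μ) [Nonempty X] :
    ∃ m : ℝ, 0 < m ∧ ∀ x, m ≤ μ x := by
  obtain ⟨x, hx⟩ := Finite.exists_min μ
  exact ⟨_, hQ.mu_pos x, hx⟩

variable {H : X → ℝ} {f : ℝ → ℝ} {c β : ℝ}

/-- Variance as half the mean squared difference of two independent samples: this allows a
pair-by-pair comparison with the Dirichlet form. -/
theorem wInner_self_eq_of_mean_zero (hQ : IsProposal Q μ) [Nonempty X] {l : X → ℝ}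
    (hl : ∑ x, gibbs μ H f c β x * l x = 0) :
    wInner (gibbs μ H f c β) l l =
      1 / 2 * ∑ x, ∑ y, gibbs μ H f c β x * gibbs μ H f c β y * (l x - l y) ^ 2 := by
  set π := gibbs μ H f c β
  have h1 : ∑ x, π x = 1 := gibbs_sum hQ
  have e : ∀ x, ∑ y, π x * π y * (l x - l y) ^ 2 =
      l x * l x * π x * ∑ y, π y + π x * ∑ y, l y * l y * π y
        - 2 * (π x * l x) * ∑ y, π y * l y := by
    intro x
    simp only [Finset.mul_sum, ← Finset.sum_add_distrib, ← Finset.sum_sub_distrib]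
    exact Finset.sum_congr rfl fun y _ => by ring
  simp only [e, h1, hl, mul_zero, sub_zero, mul_one, Finset.sum_add_distrib, ← Finset.sum_mul]
  unfold wInner
  ring

/-- A single edge below level `a` carries flow at least `q e^{-a}/Z`, and its term is part of the
whole Dirichlet sum. -/
theorem sq_sub_mul_le_dirichlet (hQ : IsProposal Q μ) [Nonempty X] {q : ℝ}
    (hq : ∀ x y, 0 < Q x y → q ≤ μ x * Q x y) (l : X → ℝ) {z w : X} {a : ℝ} (hzw : 0 < Q z w)
    (hz : modH H f c β z ≤ a) (hw : modH H f c β w ≤ a) :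
    q * Real.exp (-a) / partFn μ H f c β * (l z - l w) ^ 2 ≤
      2 * wInner (gibbs μ H f c β) (-((gen Q H f c β).mulVec l)) l := by
  have hZ := partFn_pos (H := H) (f := f) (c := c) (β := β) hQ
  have h1 : q * Real.exp (-a) / partFn μ H f c β ≤
      gibbs μ H f c β z * rate Q H f c β z w := by
    rw [gibbs_mul_rate]
    refine div_le_div_of_nonneg_right (mul_le_mul (hq z w hzw) ?_ (Real.exp_pos _).le
      (mul_pos (hQ.mu_pos z) hzw).le) hZ.le
    exact Real.exp_le_exp.2 (neg_le_neg (max_le hz hw))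
  rw [wInner_neg_gen hQ, ← mul_assoc, mul_one_div_cancel two_ne_zero, one_mul]
  refine (mul_le_mul_of_nonneg_right h1 (sq_nonneg _)).trans ?_
  have h2 := Finset.single_le_sum (f := fun y => gibbs μ H f c β z * rate Q H f c β z y *
    (l z - l y) ^ 2) (fun y _ => dirichlet_term_nonneg hQ l z y) (Finset.mem_univ w)
  have h3 := Finset.single_le_sum (f := fun x => ∑ y, gibbs μ H f c β x * rate Q H f c β x y *
    (l x - l y) ^ 2) (fun x _ => Finset.sum_nonneg fun y _ => dirichlet_term_nonneg hQ l x y)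
    (Finset.mem_univ z)
  exact h2.trans h3

/-- Follow a path of lowest elevation `a` and add up the edge bounds. The weights at `x` and `y`
turn `e^a` into `e^{a - U x - U y}`, at most `exp(modHeight)`. One `Z` cancels; the other is at
least `m`, at every temperature. The factor `μ x * μ y` is kept because it sums to `1`. -/
theorem gibbs_mul_sq_sub_le (hQ : IsProposal Q μ) [Nonempty X] {q m : ℝ} (hq0 : 0 < q)
    (hq : ∀ x y, 0 < Q x y → q ≤ μ x * Q x y) (hm0 : 0 < m) (hm : ∀ x, m ≤ μ x)
    (l : X → ℝ) (x y : X) :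
    gibbs μ H f c β x * gibbs μ H f c β y * (l x - l y) ^ 2 ≤
      μ x * μ y * (2 * ((Fintype.card X : ℝ) ^ 2 / (q * m) * Real.exp (modHeight Q H f c β) *
        wInner (gibbs μ H f c β) (-((gen Q H f c β).mulVec l)) l)) := by
  set E := wInner (gibbs μ H f c β) (-((gen Q H f c β).mulVec l)) l with hE
  have hE0 : 0 ≤ E := wInner_neg_gen_nonneg hQ l
  set Z := partFn μ H f c β with hZdef
  have hZ : 0 < Z := partFn_pos hQ
  have hmZ : m ≤ Z := by
    obtain ⟨x, hx⟩ := exists_eq_minH H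
    exact (hm x).trans (le_partFn_of_eq_minH hQ hx)
  set U := modH H f c β with hU
  set a := commHeight Q U x y with ha
  obtain ⟨n, γ, hγ, hγa⟩ := exists_path_le_commHeight U (hQ.irreducible x y)
  set D := 2 * E * Z * Real.exp a / q with hD
  have hD0 : 0 ≤ D := by positivity
  have hstep : ∀ z w, 0 < Q z w → U z ≤ a → U w ≤ a → |l z - l w| ≤ √D := by
    intro z w hzw hz hw
    refine Real.abs_le_sqrt ?_
    have h := sq_sub_mul_le_dirichlet hQ hq l hzw hz hw
    rw [← hE, ← hZdef, Real.exp_neg] at h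
    rw [hD, le_div_iff₀ hq0]
    have e : (l z - l w) ^ 2 * q =
        (q * (Real.exp a)⁻¹ / Z * (l z - l w) ^ 2) * (Z * Real.exp a) := by
      field_simp
    rw [e]
    calc _ ≤ 2 * E * (Z * Real.exp a) := mul_le_mul_of_nonneg_right h (by positivity)
      _ = _ := by ring
  have hxy := abs_sub_le_of_isPath (Real.sqrt_nonneg D) hstep hγ hγa
  have hsq : (l x - l y) ^ 2 ≤ (Fintype.card X : ℝ) ^ 2 * D := by
    rw [← sq_abs]
    calc _ ≤ ((Fintype.card X : ℝ) * √D) ^ 2 := pow_le_pow_left₀ (abs_nonneg _) hxy 2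
      _ = _ := by rw [mul_pow, Real.sq_sqrt hD0]
  have hH : a - U x - U y ≤ modHeight Q H f c β :=
    le_ciSup (f := fun z : X × X => commHeight Q (modH H f c β) z.1 z.2 - modH H f c β z.1 -
      modH H f c β z.2) (Set.finite_range _).bddAbove (x, y)
  have hμx := hQ.mu_pos x
  have hμy := hQ.mu_pos y
  rw [gibbs_eq, gibbs_eq]
  calc Real.exp (-U x) * μ x / Z * (Real.exp (-U y) * μ y / Z) * (l x - l y) ^ 2
      ≤ Real.exp (-U x) * μ x / Z * (Real.exp (-U y) * μ y / Z) *
        ((Fintype.card X : ℝ) ^ 2 * D) := mul_le_mul_of_nonneg_left hsq (by positivity)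
    _ = μ x * μ y * (2 * ((Fintype.card X : ℝ) ^ 2 / (q * Z) *
        (Real.exp a * Real.exp (-U x) * Real.exp (-U y)) * E)) := by
      rw [hD]; field_simp
    _ = μ x * μ y * (2 * ((Fintype.card X : ℝ) ^ 2 / (q * Z) * Real.exp (a - U x - U y) * E)) := by
      rw [sub_eq_add_neg, sub_eq_add_neg, Real.exp_add, Real.exp_add]
    _ ≤ _ := by gcongr

/-- There is a gap constant that depends only on `Q` and `μ`. -/
theorem exists_isGapConst [Nontrivial X] (hQ : IsProposal Q μ) :
    ∃ C₂ : ℝ, ∀ (H : X → ℝ) (f : ℝ → ℝ) (c : ℝ), IsGapConst Q μ H f c C₂ := by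
  obtain ⟨q, hq0, hq⟩ := exists_pos_le_flow hQ
  obtain ⟨m, hm0, hm⟩ := exists_pos_le_mu hQ
  have hN : (0 : ℝ) < Fintype.card X := by exact_mod_cast Fintype.card_pos
  refine ⟨q * m / (Fintype.card X : ℝ) ^ 2, fun H f c => ⟨by positivity, fun β _ => ?_⟩⟩
  refine le_spectralGap hQ fun l hl => ?_
  set E := wInner (gibbs μ H f c β) (-((gen Q H f c β).mulVec l)) l with hE
  have key : wInner (gibbs μ H f c β) l l ≤
      (Fintype.card X : ℝ) ^ 2 / (q * m) * Real.exp (modHeight Q H f c β) * E := by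
    rw [wInner_self_eq_of_mean_zero hQ hl]
    have h := Finset.sum_le_sum fun x (_ : x ∈ Finset.univ) =>
      Finset.sum_le_sum fun y (_ : y ∈ Finset.univ) =>
        gibbs_mul_sq_sub_le (H := H) (f := f) (c := c) (β := β) hQ hq0 hq hm0 hm l x y
    simp only [← Finset.sum_mul, ← Finset.mul_sum, hQ.prob_sum, mul_one, one_mul] at h
    linarith
  calc _ ≤ q * m / (Fintype.card X : ℝ) ^ 2 * Real.exp (-modHeight Q H f c β) *
        ((Fintype.card X : ℝ) ^ 2 / (q * m) * Real.exp (modHeight Q H f c β) * E) :=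
        mul_le_mul_of_nonneg_left key (by positivity)
    _ = (Real.exp (-modHeight Q H f c β) * Real.exp (modHeight Q H f c β)) * E := by
      field_simp
    _ = E := by rw [← Real.exp_add]; simp

end Gap

/-! ### The schedule and the constants -/

section Constants

variable {Q : Matrix X X ℝ} {μ H : X → ℝ} {f : ℝ → ℝ} {c β ε C₂ : ℝ}

theorem osc_pos (hε : maxH H - c < ε) (hε' : ε < osc H + maxH H - c) : 0 < osc H := by
  linarith

/-- Thus `M ε̄` is exactly the margin by which `ε` exceeds `max H - c`. -/
theorem epsBar_eq (hε : maxH H - c < ε) (hε' : ε < osc H + maxH H - c) :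
    epsBar H c ε = (ε + c - maxH H) / osc H := by
  have h1 := osc_pos hε hε'
  have h2 : osc H + maxH H - ε - c ≠ 0 := by linarith
  unfold epsBar pExp
  field_simp
  ring

theorem epsBar_pos (hε : maxH H - c < ε) (hε' : ε < osc H + maxH H - c) : 0 < epsBar H c ε := by
  rw [epsBar_eq hε hε']
  exact div_pos (by linarith) (osc_pos hε hε')

theorem epsBar_le_one (hε : maxH H - c < ε) (hε' : ε < osc H + maxH H - c) :
    epsBar H c ε ≤ 1 := by
  rw [epsBar_eq hε hε', div_le_one (osc_pos hε hε')]
  linarith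

theorem osc_mul_epsBar (hε : maxH H - c < ε) (hε' : ε < osc H + maxH H - c) :
    osc H * epsBar H c ε = ε + c - maxH H := by
  rw [epsBar_eq hε hε', mul_div_cancel₀ _ (osc_pos hε hε').ne']

theorem invTemp_pos (h : 0 < clippedHeight Q H c + ε) {t : ℝ} (ht : 0 < t) :
    0 < invTemp Q H c ε t :=
  div_pos (Real.log_pos (by linarith)) h

theorem invTemp_nonneg (h : 0 < clippedHeight Q H c + ε) {t : ℝ} (ht : 0 ≤ t) :
    0 ≤ invTemp Q H c ε t :=
  div_nonneg (Real.log_nonneg (by linarith)) h.le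

theorem temp_pos (h : 0 < clippedHeight Q H c + ε) {t : ℝ} (ht : 0 < t) :
    0 < temp Q H c ε t :=
  div_pos h (Real.log_pos (by linarith))

variable [Fintype X]

/-- Use a path optimal for `H`, not for `modH`. The clipping error enters only through the
elevation, so `max H - c` is paid once; the endpoints need only lower bounds. -/
theorem modHeight_le [Nonempty X] (hQ : IsProposal Q μ) (hf : IsModFun f) (hβ : 0 ≤ β)
    (hc : minH H ≤ c) (hc' : c ≤ maxH H) :
    modHeight Q H f c β ≤ β * (clippedHeight Q H c + (maxH H - c)) := by
  refine ciSup_le fun ⟨x, y⟩ => ?_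
  obtain ⟨n, γ, hγ, hγG⟩ := exists_path_le_commHeight H (hQ.irreducible x y)
  have h1 : commHeight Q (modH H f c β) x y ≤
      β * (min (commHeight Q H x y) c - minH H) + β * (maxH H - c) := by
    refine commHeight_le hγ fun i => (modH_le_mul_clip_add hf hβ hc hc' (γ i)).trans ?_
    have := hγG i
    gcongr
  have h2 : min (commHeight Q H x y) c - min (H x) c - min (H y) c + minH H ≤
      clippedHeight Q H c :=
    le_ciSup (f := fun z : X × X => min (commHeight Q H z.1 z.2) c - min (H z.1) c -
      min (H z.2) c + minH H) (Set.finite_range _).bddAbove (x, y)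
  have h3 := mul_le_mul_of_nonneg_left h2 hβ
  have hx := mul_clip_le_modH hf hβ hc x
  have hy := mul_clip_le_modH hf hβ hc y
  dsimp only
  linarith

theorem clippedHeight_nonneg [Nonempty X] (hQ : IsProposal Q μ) (hc : minH H ≤ c) :
    0 ≤ clippedHeight Q H c := by
  obtain ⟨x, hx⟩ := exists_eq_minH H
  obtain ⟨n, γ, hγ, hγG⟩ := exists_path_le_commHeight H (hQ.irreducible x x)
  have h1 : minH H ≤ commHeight Q H x x := hx ▸ hγ.1 ▸ hγG 0
  have h2 : min (commHeight Q H x x) c - min (H x) c - min (H x) c + minH H ≤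
      clippedHeight Q H c :=
    le_ciSup (f := fun z : X × X => min (commHeight Q H z.1 z.2) c - min (H z.1) c -
      min (H z.2) c + minH H) (Set.finite_range _).bddAbove (x, x)
  rw [hx, min_eq_left hc] at h2
  linarith [le_min h1 hc]

theorem clippedHeight_add_pos [Nonempty X] (hQ : IsProposal Q μ) (hc : minH H ≤ c)
    (hc' : c ≤ maxH H) (hε : maxH H - c < ε) : 0 < clippedHeight Q H c + ε := by
  linarith [clippedHeight_nonneg hQ hc]

theorem iInf_mu_pos [Nonempty X] (hQ : IsProposal Q μ) : 0 < ⨅ x, μ x := by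
  obtain ⟨x, hx⟩ := exists_eq_ciInf_of_finite (f := μ)
  exact hx ▸ hQ.mu_pos x

theorem iInf_mu_le (μ : X → ℝ) (x : X) : ⨅ x, μ x ≤ μ x :=
  ciInf_le (Set.finite_range μ).bddBelow x

/-- The extra exponential in `constA` is at least `1`, since `gapAbove` and `f` are nonnegative. -/
theorem le_constA [Nonempty X] (hQ : IsProposal Q μ) (hf : IsModFun f) (hC : 0 < C₂)
    (hε : maxH H - c < ε) (hε' : ε < osc H + maxH H - c) :
    1 / (C₂ * (⨅ x, μ x) ^ epsBar H c ε) ≤ constA μ H f c ε C₂ := by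
  have h0 : 0 ≤ 1 / (C₂ * (⨅ x, μ x) ^ epsBar H c ε) :=
    one_div_nonneg.2 (mul_nonneg hC.le (Real.rpow_nonneg (iInf_mu_pos hQ).le _))
  unfold constA
  split_ifs with h
  · refine le_mul_of_one_le_right h0 (Real.one_le_exp ?_)
    refine mul_nonneg (one_div_nonneg.2 (hf.nonneg _ (Real.sInf_nonneg ?_))) (osc_pos hε hε').le
    rintro _ ⟨x, hx, rfl⟩
    exact sub_nonneg.2 (le_of_lt hx)
  · exact le_rfl

theorem constA_pos [Nonempty X] (hQ : IsProposal Q μ) (hf : IsModFun f) (hC : 0 < C₂)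
    (hε : maxH H - c < ε) (hε' : ε < osc H + maxH H - c) : 0 < constA μ H f c ε C₂ :=
  (one_div_pos.2 (mul_pos hC (Real.rpow_pos_of_pos (iInf_mu_pos hQ) _))).trans_le
    (le_constA hQ hf hC hε hε')

theorem le_gibbs [Nonempty X] (hQ : IsProposal Q μ) (hf : IsModFun f) (hβ : 0 ≤ β) (x : X) :
    (⨅ x, μ x) * Real.exp (-(β * osc H)) ≤ gibbs μ H f c β x := by
  rw [gibbs_eq, le_div_iff₀ (partFn_pos hQ)]
  have h0 := (mul_pos (iInf_mu_pos hQ) (Real.exp_pos (-(β * osc H)))).le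
  refine (mul_le_of_le_one_right h0 (partFn_le_one hQ hf hβ)).trans ?_
  rw [mul_comm]
  exact mul_le_mul (Real.exp_le_exp.2 (neg_le_neg (modH_le_mul_osc hf hβ x))) (iInf_mu_le μ x)
    (iInf_mu_pos hQ).le (Real.exp_pos _).le

/-- Along the schedule, the spectral gap dominates `π(x) ^ (-ε̄) / (A (1 + t))`. -/
theorem gibbs_rpow_le_gap [Nonempty X] (hQ : IsProposal Q μ) (hf : IsModFun f)
    (hc : minH H ≤ c) (hc' : c ≤ maxH H) (hC : IsGapConst Q μ H f c C₂)
    (hε : maxH H - c < ε) (hε' : ε < osc H + maxH H - c) {t : ℝ} (ht : 0 < t) (x : X) :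
    gibbs μ H f c (invTemp Q H c ε t) x ^ (-epsBar H c ε) ≤
      constA μ H f c ε C₂ * (1 + t) *
        spectralGap (gibbs μ H f c (invTemp Q H c ε t)) (gen Q H f c (invTemp Q H c ε t)) := by
  have hD := clippedHeight_add_pos hQ hc hc' hε
  set β := invTemp Q H c ε t with hβdef
  have hβ : 0 < β := invTemp_pos hD ht
  have hm := iInf_mu_pos hQ
  have hA := constA_pos hQ hf hC.1 hε hε'
  have hβD : β * (clippedHeight Q H c + ε) = Real.log (t + 1) := div_mul_cancel₀ _ hD.ne'
  calc gibbs μ H f c β x ^ (-epsBar H c ε)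
      ≤ ((⨅ x, μ x) * Real.exp (-(β * osc H))) ^ (-epsBar H c ε) :=
        Real.rpow_le_rpow_of_nonpos (mul_pos hm (Real.exp_pos _)) (le_gibbs hQ hf hβ.le x)
          (neg_nonpos.2 (epsBar_pos hε hε').le)
    _ = ((⨅ x, μ x) ^ epsBar H c ε)⁻¹ * Real.exp (β * (osc H * epsBar H c ε)) := by
        rw [Real.mul_rpow hm.le (Real.exp_pos _).le, Real.rpow_neg hm.le, ← Real.exp_mul]
        congr 2
        ring
    _ = (1 / (C₂ * (⨅ x, μ x) ^ epsBar H c ε)) * (1 + t) *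
        (C₂ * Real.exp (-(β * (clippedHeight Q H c + (maxH H - c))))) := by
        -- Here `M ε̄ = (c* + ε) - (c* + max H - c)` and `β (c* + ε) = ln(t+1)`: the exponential
        -- splits into `1 + t` and the lower bound for the gap.
        have e : β * (osc H * epsBar H c ε) = Real.log (t + 1) +
            -(β * (clippedHeight Q H c + (maxH H - c))) := by
          rw [osc_mul_epsBar hε hε', ← hβD]; ring
        have hC0 := hC.1.ne'
        have := (Real.rpow_pos_of_pos hm (epsBar H c ε)).ne'
        rw [e, Real.exp_add, Real.exp_log (by linarith)]
        field_simp
        ring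
    _ ≤ constA μ H f c ε C₂ * (1 + t) * spectralGap (gibbs μ H f c β) (gen Q H f c β) := by
        have h1 := le_constA hQ hf hC.1 hε hε'
        have h2 : C₂ * Real.exp (-(β * (clippedHeight Q H c + (maxH H - c)))) ≤
            spectralGap (gibbs μ H f c β) (gen Q H f c β) :=
          (mul_le_mul_of_nonneg_left (Real.exp_le_exp.2 (neg_le_neg
            (modHeight_le hQ hf hβ.le hc hc'))) hC.1.le).trans (hC.2 β hβ)
        have := hC.1
        gcongr

end Constants

/-! ### The Gibbs mass off the minimisers -/

section OffMin

variable [Fintype X] {Q : Matrix X X ℝ} {μ H : X → ℝ} {f : ℝ → ℝ} {c β ε : ℝ}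

theorem mass_argminSet_pos [Nonempty X] (hQ : IsProposal Q μ) : 0 < mass μ (argminSet H) := by
  obtain ⟨x, hx⟩ := exists_eq_minH H
  refine Finset.sum_pos' (fun x _ => Set.indicator_nonneg (fun y _ => hQ.prob_nonneg y) x)
    ⟨x, Finset.mem_univ x, ?_⟩
  rw [Set.indicator_of_mem (show x ∈ argminSet H from hx)]
  exact hQ.mu_pos x

theorem mass_argminSet_le_partFn (hQ : IsProposal Q μ) :
    mass μ (argminSet H) ≤ partFn μ H f c β := by
  refine Finset.sum_le_sum fun x _ => ?_
  by_cases hx : x ∈ argminSet H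
  · rw [Set.indicator_of_mem hx, modH_of_eq_minH hx]; simp
  · rw [Set.indicator_of_notMem hx]
    exact mul_nonneg (Real.exp_pos _).le (hQ.prob_nonneg x)

/-- The partition function is at least `μ(S_min)`, as `modH` vanishes on the minimisers. -/
theorem mass_gibbs_le [Nonempty X] (hQ : IsProposal Q μ) {a : ℝ}
    (ha : ∀ x, x ∉ argminSet H → a ≤ modH H f c β x) :
    mass (gibbs μ H f c β) (argminSet H)ᶜ ≤ 1 / mass μ (argminSet H) * Real.exp (-a) := by
  have hS := mass_argminSet_pos (H := H) hQ
  calc mass (gibbs μ H f c β) (argminSet H)ᶜ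
      ≤ ∑ x, 1 / mass μ (argminSet H) * Real.exp (-a) * μ x := by
        refine Finset.sum_le_sum fun x _ => ?_
        have hμ := hQ.mu_pos x
        by_cases hx : x ∈ argminSet H
        · rw [Set.indicator_of_notMem (by simpa using hx)]
          positivity
        · rw [Set.indicator_of_mem hx, gibbs_eq, one_div_mul_eq_div, div_mul_eq_mul_div]
          have h1 := mass_argminSet_le_partFn (H := H) (f := f) (c := c) (β := β) hQ
          have h2 := ha x hx
          gcongr
    _ = _ := by rw [← Finset.mul_sum, hQ.prob_sum, mul_one]

theorem secondMin_le {x : X} (hx : x ∉ argminSet H) : secondMin H ≤ H x :=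
  csInf_le ((Set.toFinite _).image H).bddBelow ⟨x, hx, rfl⟩

theorem minH_lt_secondMin [Nonempty X] (h : 0 < osc H) : minH H < secondMin H := by
  have hne : (H '' {x | H x ≠ minH H}).Nonempty := by
    obtain ⟨x, hx⟩ := exists_eq_ciSup_of_finite (f := H)
    refine ⟨H x, x, fun h' => ?_, rfl⟩
    have h2 : H x = maxH H := hx
    unfold osc at h
    linarith
  obtain ⟨x, hx, hx'⟩ := hne.csInf_mem ((Set.toFinite _).image H)
  rw [secondMin, ← hx']
  exact lt_of_le_of_ne (minH_le H x) (Ne.symm hx)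

theorem offMin_le_of_secondMin_le [Nonempty X] (hQ : IsProposal Q μ) (hf : IsModFun f)
    (h0 : 0 < osc H) (hd : secondMin H ≤ c) {t : ℝ} (hβ : 0 ≤ invTemp Q H c ε t) :
    offMin Q μ H f c ε t ≤ 1 / mass μ (argminSet H) *
      Real.exp (-(invTemp Q H c ε t * (secondMin H - minH H))) := by
  refine mass_gibbs_le hQ fun x hx => ?_
  rw [← integral_integrand_of_le hf (minH_lt_secondMin h0).le hd]
  exact integral_le_modH hf hβ (secondMin_le hx)

theorem offMin_le_of_lt_secondMin [Nonempty X] (hQ : IsProposal Q μ) (hf : IsModFun f)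
    (hc : minH H ≤ c) (hd : c < secondMin H) {t : ℝ} (hτ : 0 < temp Q H c ε t) :
    offMin Q μ H f c ε t ≤ 1 / mass μ (argminSet H) *
      Real.exp (-∫ u in c..(secondMin H), 1 / (f (u - c) + temp Q H c ε t)) := by
  have hβ : 0 ≤ invTemp Q H c ε t := by rw [invTemp_eq]; positivity
  refine mass_gibbs_le hQ fun x hx => le_trans ?_ (integral_le_modH hf hβ (secondMin_le hx))
  rw [← integral_integrand_add hf hβ (minH H) c]
  refine le_trans (le_of_eq ?_) (le_add_of_nonneg_left (integral_integrand_nonneg hf hβ hc))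
  refine intervalIntegral.integral_congr fun u hu => ?_
  rw [Set.uIcc_of_le hd.le] at hu
  have : 0 ≤ f (u - c) := hf.nonneg _ (sub_nonneg.2 hu.1)
  rw [max_eq_left (sub_nonneg.2 hu.1), invTemp_eq]
  field_simp

/-- Differentiability at `0` with `f 0 = 0` gives `f u = O(u)`; this makes `∫ du / f` diverge at
`0`. -/
theorem IsModFun.exists_linear_bound (hf : IsModFun f) {r : ℝ} (hr : 0 < r) :
    ∃ C η : ℝ, 0 < C ∧ 0 < η ∧ η ≤ r ∧ ∀ u, 0 ≤ u → u ≤ η → f u ≤ C * u := by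
  have h := (hf.differentiable 0 Set.self_mem_Ici).hasDerivWithinAt.hasFDerivWithinAt.isBigO_sub
  obtain ⟨C, hC, h⟩ := h.exists_pos
  obtain ⟨δ, hδ, hb⟩ := Metric.mem_nhdsWithin_iff.1 h.bound
  refine ⟨C, min (δ / 2) r, hC, lt_min (by positivity) hr, min_le_right _ _, fun u hu hu' => ?_⟩
  have := hb (show u ∈ Metric.ball 0 δ ∩ Set.Ici 0 from ⟨by
    rw [Metric.mem_ball, Real.dist_eq, sub_zero, abs_of_nonneg hu]
    linarith [min_le_left (δ / 2) r], hu⟩)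
  simp only [Set.mem_ofPred_eq, hf.zero, sub_zero, Real.norm_eq_abs, abs_of_nonneg hu] at this
  exact (le_abs_self _).trans this

/-- The modified energy barrier above `c` diverges as the temperature tends to zero. -/
theorem tendsto_integral_atTop (hf : IsModFun f) {c d : ℝ} (hcd : c < d) :
    Tendsto (fun τ : ℝ => ∫ u in c..d, 1 / (f (u - c) + τ)) (𝓝[>] 0) atTop := by
  obtain ⟨C, η, hC, hη, hηd, hb⟩ := hf.exists_linear_bound (sub_pos.2 hcd)
  -- Compare with `∫ du/(C (u - c) + τ)` over `[c, c + η]`, which is `(log (C η + τ) - log τ)/C`.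
  have hlim : Tendsto (fun τ : ℝ => (Real.log (C * η) - Real.log τ) / C) (𝓝[>] 0) atTop :=
    (tendsto_atTop_add_const_left _ _ (tendsto_neg_atBot_atTop.comp
      Real.tendsto_log_nhdsGT_zero)).atTop_div_const hC
  refine tendsto_atTop_mono' _ ?_ hlim
  filter_upwards [self_mem_nhdsWithin] with τ hτ
  have hτ : 0 < τ := hτ
  have hcont : ContinuousOn (fun u => 1 / (f (u - c) + τ)) (Set.Icc c d) := by
    refine continuousOn_const.div ((hf.differentiable.continuousOn.comp (by fun_prop)
      fun u hu => Set.mem_Ici.2 (sub_nonneg.2 hu.1)).add continuousOn_const) fun u hu => ?_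
    exact (add_pos_of_nonneg_of_pos (hf.nonneg _ (sub_nonneg.2 hu.1)) hτ).ne'
  have hint : ∀ a b, c ≤ a → a ≤ b → b ≤ d →
      IntervalIntegrable (fun u => 1 / (f (u - c) + τ)) volume a b := fun a b ha hab hbd =>
    (hcont.mono (Set.Icc_subset_Icc ha hbd)).intervalIntegrable_of_Icc hab
  have hden : ∀ u ∈ Set.Icc c (c + η), 0 < C * (u - c) + τ := fun u hu => by
    have : 0 ≤ u - c := sub_nonneg.2 hu.1
    positivity
  have hcont' : ContinuousOn (fun u => 1 / (C * (u - c) + τ)) (Set.Icc c (c + η)) :=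
    continuousOn_const.div (by fun_prop) fun u hu => (hden u hu).ne'
  have hcη : c ≤ c + η := by linarith
  have hint' : IntervalIntegrable (fun u => 1 / (C * (u - c) + τ)) volume c (c + η) :=
    hcont'.intervalIntegrable_of_Icc hcη
  have hlog : ∫ u in c..(c + η), 1 / (C * (u - c) + τ) =
      Real.log (C * (c + η - c) + τ) / C - Real.log (C * (c - c) + τ) / C := by
    refine intervalIntegral.integral_eq_sub_of_hasDerivAt
      (f := fun u => Real.log (C * (u - c) + τ) / C) (fun u hu => ?_) hint'
    rw [Set.uIcc_of_le hcη] at hu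
    have h1 : HasDerivAt (fun u => C * (u - c) + τ) (C * 1) u :=
      (((hasDerivAt_id u).sub_const c).const_mul C).add_const τ
    have h2 := (hden u hu).ne'
    have h3 := (h1.log h2).div_const C
    rwa [mul_one, div_right_comm, div_self hC.ne'] at h3
  calc (Real.log (C * η) - Real.log τ) / C
      ≤ ∫ u in c..(c + η), 1 / (C * (u - c) + τ) := by
        rw [hlog, ← sub_div]
        have : Real.log (C * η) ≤ Real.log (C * (c + η - c) + τ) :=
          Real.log_le_log (by positivity) (by ring_nf; linarith)
        rw [sub_self, mul_zero, zero_add]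
        gcongr
    _ ≤ ∫ u in c..(c + η), 1 / (f (u - c) + τ) := by
        refine intervalIntegral.integral_mono_on hcη hint' (hint _ _ le_rfl hcη (by linarith))
          fun u hu => ?_
        have h0 : 0 ≤ u - c := sub_nonneg.2 hu.1
        have h1 := hf.nonneg _ h0
        have h2 := hb (u - c) h0 (by linarith [hu.2])
        exact one_div_le_one_div_of_le (by positivity) (by linarith)
    _ ≤ ∫ u in c..d, 1 / (f (u - c) + τ) := by
        rw [← intervalIntegral.integral_add_adjacent_intervals
          (hint c (c + η) le_rfl hcη (by linarith)) (hint (c + η) d hcη (by linarith) le_rfl)]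
        refine le_add_of_nonneg_right (intervalIntegral.integral_nonneg (by linarith)
          fun u hu => ?_)
        have := hf.nonneg (u - c) (by linarith [hu.1])
        positivity

theorem offMin_nonneg (hQ : IsProposal Q μ) (t : ℝ) : 0 ≤ offMin Q μ H f c ε t :=
  Finset.sum_nonneg fun x _ => Set.indicator_nonneg (fun y _ => (gibbs_pos hQ y).le) x

theorem tendsto_offMin [Nonempty X] (hQ : IsProposal Q μ) (hf : IsModFun f)
    (hc : minH H ≤ c) (hc' : c ≤ maxH H) (hε : maxH H - c < ε) (hε' : ε < osc H + maxH H - c) :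
    Tendsto (fun t => offMin Q μ H f c ε t) atTop (𝓝 0) := by
  have hD := clippedHeight_add_pos hQ hc hc' hε
  have h0 := osc_pos hε hε'
  have hlog : Tendsto (fun t : ℝ => Real.log (t + 1)) atTop atTop :=
    Real.tendsto_log_atTop.comp (tendsto_atTop_add_const_right _ _ tendsto_id)
  suffices h : ∃ g : ℝ → ℝ, Tendsto g atTop atTop ∧ ∀ t, 0 < t →
      offMin Q μ H f c ε t ≤ 1 / mass μ (argminSet H) * Real.exp (-g t) by
    obtain ⟨g, hg, hle⟩ := h
    have hlim := (Real.tendsto_exp_neg_atTop_nhds_zero.comp hg).const_mul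
      (1 / mass μ (argminSet H))
    rw [mul_zero] at hlim
    refine tendsto_of_tendsto_of_tendsto_of_le_of_le' tendsto_const_nhds hlim
      (Eventually.of_forall fun t => offMin_nonneg hQ t) ?_
    filter_upwards [eventually_gt_atTop 0] with t ht using hle t ht
  rcases le_or_gt (secondMin H) c with hd | hd
  · exact ⟨_, (hlog.atTop_div_const hD).atTop_mul_const (sub_pos.2 (minH_lt_secondMin h0)),
      fun t ht => offMin_le_of_secondMin_le hQ hf h0 hd (invTemp_nonneg hD ht.le)⟩
  · refine ⟨_, (tendsto_integral_atTop hf hd).comp (f := fun t => temp Q H c ε t)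
      (tendsto_nhdsWithin_iff.2 ⟨hlog.const_div_atTop _, ?_⟩),
      fun t ht => offMin_le_of_lt_secondMin hQ hf hc hd (temp_pos hD ht)⟩
    filter_upwards [eventually_gt_atTop 0] with t ht using temp_pos hD ht

theorem tendsto_hitBound [Nonempty X] {C₂ : ℝ} (hQ : IsProposal Q μ) (hf : IsModFun f)
    (hc : minH H ≤ c) (hc' : c ≤ maxH H) (hε : maxH H - c < ε) (hε' : ε < osc H + maxH H - c) :
    Tendsto (fun t => hitBound Q μ H f c ε C₂ t) atTop (𝓝 0) := by
  have h := tendsto_offMin hQ hf hc hc' hε hε'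
  simpa [hitBound] using (h.sqrt.const_mul (1 + constK (constA μ H f c ε C₂) (constB Q H c ε) ^
    (1 / (2 * epsBar H c ε)))).add h

end OffMin

/-! ### Dependence of the Gibbs weights on the inverse temperature -/

section Temperature

variable {H : X → ℝ} {f : ℝ → ℝ} {c β : ℝ}

/-- The `β`-derivative of the integrand is `1/(β f + 1)²`, between `0` and `1`; the same bound `1`
justifies differentiating under the integral. -/
theorem hasDerivAt_modH [Finite X] (hf : IsModFun f) (hβ : 0 < β) (x : X) :
    ∃ U', HasDerivAt (fun β => modH H f c β x) U' β ∧ U' ≤ osc H ∧ 0 ≤ U' := by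
  have hle := minH_le H x
  have hden : ∀ b : ℝ, 0 < b → ∀ u, 1 ≤ b * f (max (u - c) 0) + 1 :=
    fun b hb u => one_le_denom hf hb.le u
  have hcont : Continuous fun u => 1 / (β * f (max (u - c) 0) + 1) ^ 2 := by
    refine continuous_const.div (((continuous_const.mul (hf.continuous_clip c)).add
      continuous_const).pow 2) fun u => ?_
    have := hden β hβ u
    positivity
  have hbound : ∀ b : ℝ, 0 < b → ∀ u, 1 / (b * f (max (u - c) 0) + 1) ^ 2 ≤ 1 := fun b hb u =>
    div_le_one_of_le₀ (one_le_pow₀ (hden b hb u)) (sq_nonneg _)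
  refine ⟨∫ u in (minH H)..(H x), 1 / (β * f (max (u - c) 0) + 1) ^ 2, ?_, ?_, ?_⟩
  · refine (intervalIntegral.hasDerivAt_integral_of_dominated_loc_of_deriv_le
      (F := fun b u => b / (b * f (max (u - c) 0) + 1))
      (F' := fun b u => 1 / (b * f (max (u - c) 0) + 1) ^ 2) (bound := fun _ => 1)
      (Ioi_mem_nhds hβ) ?_ ((continuous_integrand hf hβ.le).intervalIntegrable _ _)
      hcont.aestronglyMeasurable ?_ intervalIntegrable_const ?_).2
    · filter_upwards [Ioi_mem_nhds hβ] with b hb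
      exact (continuous_integrand hf (le_of_lt hb)).aestronglyMeasurable
    · refine Eventually.of_forall fun u _ b hb => ?_
      rw [Real.norm_of_nonneg (by positivity)]
      exact hbound b hb u
    · refine Eventually.of_forall fun u _ b hb => ?_
      have h0 : b * f (max (u - c) 0) + 1 ≠ 0 := by linarith [hden b hb u]
      have h1 : HasDerivAt (fun b => b * f (max (u - c) 0) + 1) (1 * f (max (u - c) 0)) b :=
        ((hasDerivAt_id b).mul_const _).add_const 1
      refine ((hasDerivAt_id b).fun_div h1 h0).congr_deriv ?_
      rw [id]
      ring
  · have h := intervalIntegral.integral_mono_on (g := fun _ => (1 : ℝ)) hle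
      (hcont.intervalIntegrable (μ := volume) _ _) intervalIntegrable_const
      fun u _ => hbound β hβ u
    rw [intervalIntegral.integral_const, smul_eq_mul, mul_one] at h
    unfold osc
    linarith [le_maxH H x]
  · exact intervalIntegral.integral_nonneg hle fun u _ => by positivity

theorem continuousOn_modH [Finite X] (hf : IsModFun f) (x : X) :
    ContinuousOn (fun β => modH H f c β x) (Set.Ici 0) := by
  intro β hβ
  -- The derivative is available only for `β > 0`; at `0` squeeze between `0` and `β M`.
  rcases eq_or_lt_of_le (Set.mem_Ici.1 hβ) with rfl | hβ
  · have hz : modH H f c 0 x = 0 := modH_zero H f c x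
    rw [ContinuousWithinAt, hz]
    have hlim : Tendsto (fun β : ℝ => β * osc H) (𝓝[Set.Ici 0] 0) (𝓝 0) := by
      have : Tendsto (fun β : ℝ => β * osc H) (𝓝 0) (𝓝 (0 * osc H)) :=
        tendsto_id.mul_const _
      rw [zero_mul] at this
      exact this.mono_left nhdsWithin_le_nhds
    refine tendsto_of_tendsto_of_tendsto_of_le_of_le' tendsto_const_nhds hlim ?_ ?_
    · filter_upwards [self_mem_nhdsWithin] with β hβ using modH_nonneg hf hβ x
    · filter_upwards [self_mem_nhdsWithin] with β hβ using modH_le_mul_osc hf hβ x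
  · obtain ⟨U', hU, -⟩ := hasDerivAt_modH (H := H) (c := c) hf hβ x
    exact hU.continuousAt.continuousWithinAt

variable [Fintype X] {Q : Matrix X X ℝ} {μ : X → ℝ}

theorem continuousOn_gibbs (hQ : IsProposal Q μ) (hf : IsModFun f) (x : X) :
    ContinuousOn (fun β => gibbs μ H f c β x) (Set.Ici 0) := by
  have : Nonempty X := ⟨x⟩
  have h : ∀ y, ContinuousOn (fun β => Real.exp (-modH H f c β y) * μ y) (Set.Ici 0) :=
    fun y => ((continuousOn_modH hf y).neg.rexp).mul continuousOn_const
  exact (h x).div (continuousOn_finsetSum _ fun y _ => h y) fun β _ => (partFn_pos hQ).ne'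

theorem gibbs_inv (x : X) :
    (gibbs μ H f c β x)⁻¹ = Real.exp (modH H f c β x) / μ x * partFn μ H f c β := by
  rw [gibbs_eq, Real.exp_neg, inv_div]
  by_cases h : μ x = 0
  · simp [h]
  · field_simp

/-- Write `1/π(x)` as `e^{modH x} Z/μ x`. `Z` is non-increasing in `β`, so its contribution is
dropped, and the exponential grows at rate at most `M`. -/
theorem hasDerivAt_gibbs_inv (hQ : IsProposal Q μ) (hf : IsModFun f) (hβ : 0 < β) (x : X) :
    ∃ G', HasDerivAt (fun β => (gibbs μ H f c β x)⁻¹) G' β ∧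
      G' ≤ osc H * (gibbs μ H f c β x)⁻¹ := by
  have : Nonempty X := ⟨x⟩
  choose U' hU hU1 hU0 using fun y => hasDerivAt_modH (H := H) (c := c) hf hβ y
  have hZ : HasDerivAt (fun β => partFn μ H f c β)
      (∑ y, Real.exp (-modH H f c β y) * -U' y * μ y) β :=
    HasDerivAt.fun_sum fun y _ => ((hU y).neg.exp).mul_const (μ y)
  have hG := ((hU x).exp.div_const (μ x)).mul hZ
  simp only [gibbs_inv]
  refine ⟨_, hG, ?_⟩
  have h1 : ∑ y, Real.exp (-modH H f c β y) * -U' y * μ y ≤ 0 :=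
    Finset.sum_nonpos fun y _ => mul_nonpos_of_nonpos_of_nonneg
      (mul_nonpos_of_nonneg_of_nonpos (Real.exp_pos _).le (neg_nonpos.2 (hU0 y)))
      (hQ.prob_nonneg y)
  have hμ := hQ.mu_pos x
  have hZ0 := partFn_pos (H := H) (f := f) (c := c) (β := β) hQ
  have h2 : Real.exp (modH H f c β x) / μ x *
      ∑ y, Real.exp (-modH H f c β y) * -U' y * μ y ≤ 0 :=
    mul_nonpos_of_nonneg_of_nonpos (by positivity) h1
  have h3 : U' x * (Real.exp (modH H f c β x) / μ x * partFn μ H f c β) ≤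
      osc H * (Real.exp (modH H f c β x) / μ x * partFn μ H f c β) :=
    mul_le_mul_of_nonneg_right (hU1 x) (by positivity)
  calc _ = U' x * (Real.exp (modH H f c β x) / μ x * partFn μ H f c β) +
        Real.exp (modH H f c β x) / μ x *
          ∑ y, Real.exp (-modH H f c β y) * -U' y * μ y := by ring
    _ ≤ _ := by linarith

end Temperature

/-! ### The `ℓ²`-norm of a density relative to the Gibbs distribution -/

section Energy

variable [Fintype X] {Q : Matrix X X ℝ} {μ H : X → ℝ} {f : ℝ → ℝ} {c β : ℝ}

/-- The squared `ℓ²(π)`-norm of the density of `ρ` with respect to `π`. -/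
noncomputable def densitySq (π ρ : X → ℝ) : ℝ := ∑ x, ρ x ^ 2 * (π x)⁻¹

theorem wInner_density_sub_one (hQ : IsProposal Q μ) [Nonempty X] {ρ : X → ℝ}
    (hρ : ∑ x, ρ x = 1) :
    wInner (gibbs μ H f c β) (fun x => ρ x / gibbs μ H f c β x - 1)
      (fun x => ρ x / gibbs μ H f c β x - 1) = densitySq (gibbs μ H f c β) ρ - 1 := by
  have e : ∀ x, (ρ x / gibbs μ H f c β x - 1) * (ρ x / gibbs μ H f c β x - 1) *
      gibbs μ H f c β x = ρ x ^ 2 * (gibbs μ H f c β x)⁻¹ - 2 * ρ x + gibbs μ H f c β x := by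
    intro x
    have := (gibbs_pos (H := H) (f := f) (c := c) (β := β) hQ x).ne'
    field_simp
    ring
  simp only [wInner, e, Finset.sum_add_distrib, Finset.sum_sub_distrib, ← Finset.mul_sum, hρ,
    gibbs_sum hQ, densitySq]
  ring

theorem one_le_densitySq (hQ : IsProposal Q μ) [Nonempty X] {ρ : X → ℝ}
    (hρ : ∑ x, ρ x = 1) : 1 ≤ densitySq (gibbs μ H f c β) ρ := by
  rw [← sub_nonneg, ← wInner_density_sub_one hQ hρ]
  exact Finset.sum_nonneg fun x _ => mul_nonneg (mul_self_nonneg _) (gibbs_pos hQ x).le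

/-- With `π` frozen, the right-hand side is minus half the derivative of `N` under the forward
equation. Apply the gap to `ρ/π - 1`; the Dirichlet form ignores the constant. -/
theorem spectralGap_mul_densitySq_le (hQ : IsProposal Q μ) [Nonempty X] {ρ : X → ℝ}
    (hρ : ∑ x, ρ x = 1) :
    spectralGap (gibbs μ H f c β) (gen Q H f c β) * (densitySq (gibbs μ H f c β) ρ - 1) ≤
      -∑ x, ρ x * (∑ y, ρ y * gen Q H f c β y x) * (gibbs μ H f c β x)⁻¹ := by
  have hπ := fun x => (gibbs_pos (H := H) (f := f) (c := c) (β := β) hQ x).ne'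
  set l : X → ℝ := fun x => ρ x / gibbs μ H f c β x - 1 with hl
  have hmean : ∑ x, gibbs μ H f c β x * l x = 0 := by
    have e : ∀ x, gibbs μ H f c β x * l x = ρ x - gibbs μ H f c β x := by
      intro x
      rw [hl, mul_sub, mul_div_cancel₀ _ (hπ x), mul_one]
    simp [e, hρ, gibbs_sum hQ]
  rw [← wInner_density_sub_one hQ hρ]
  refine (spectralGap_mul_le hQ hmean).trans (le_of_eq ?_)
  have h1 : wInner (gibbs μ H f c β) (-((gen Q H f c β).mulVec l)) l =
      wInner (gibbs μ H f c β) (-((gen Q H f c β).mulVec fun x => ρ x / gibbs μ H f c β x))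
        (fun x => ρ x / gibbs μ H f c β x) := by
    simp only [wInner_neg_gen hQ, hl, sub_sub_sub_cancel_right]
  rw [h1, wInner, ← Finset.sum_neg_distrib]
  simp only [Pi.neg_apply, Matrix.mulVec, dotProduct, Finset.sum_mul, Finset.mul_sum, neg_mul,
    Finset.sum_neg_distrib]
  rw [Finset.sum_comm]
  congr 1
  refine Finset.sum_congr rfl fun x _ => Finset.sum_congr rfl fun y _ => ?_
  have := hπ y
  field_simp

/-- Since `ρ² ≤ ρ`, `N` is at most `1/min π`; this crude bound plays the role of a Sobolev
inequality. -/
theorem densitySq_rpow_le (hQ : IsProposal Q μ) [Nonempty X] {ρ : X → ℝ} (hρ0 : ∀ x, 0 ≤ ρ x)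
    (hρ : ∑ x, ρ x = 1) {e a : ℝ} (he : 0 ≤ e) (ha : ∀ x, gibbs μ H f c β x ^ (-e) ≤ a) :
    densitySq (gibbs μ H f c β) ρ ^ e ≤ a := by
  obtain ⟨x₀, hx₀⟩ := Finite.exists_min (gibbs μ H f c β)
  have hpos := gibbs_pos (H := H) (f := f) (c := c) (β := β) hQ x₀
  refine le_trans ?_ (ha x₀)
  rw [Real.rpow_neg hpos.le, ← Real.inv_rpow hpos.le]
  refine Real.rpow_le_rpow (zero_le_one.trans (one_le_densitySq hQ hρ)) ?_ he
  calc densitySq (gibbs μ H f c β) ρ ≤ ∑ x, ρ x * (gibbs μ H f c β x₀)⁻¹ := by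
        refine Finset.sum_le_sum fun x _ => ?_
        have h1 : ρ x ≤ 1 := hρ ▸ Finset.single_le_sum (fun y _ => hρ0 y) (Finset.mem_univ x)
        have h2 : ρ x ^ 2 ≤ ρ x := by nlinarith [hρ0 x]
        exact mul_le_mul h2 (inv_anti₀ hpos (hx₀ x))
          (inv_nonneg.2 (gibbs_pos hQ x).le) (hρ0 x)
    _ = _ := by rw [← Finset.sum_mul, hρ, one_mul]

/-- Cauchy–Schwarz for `ρ = (ρ/√π) √π`. -/
theorem sum_indicator_le (hQ : IsProposal Q μ) (ρ : X → ℝ) (S : Set X) :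
    mass ρ S ≤ √(densitySq (gibbs μ H f c β) ρ) * √(mass (gibbs μ H f c β) S) := by
  classical
  have hπ := fun x => gibbs_pos (H := H) (f := f) (c := c) (β := β) hQ x
  have h := Real.sum_mul_le_sqrt_mul_sqrt Finset.univ
    (fun x => ρ x / √(gibbs μ H f c β x)) (fun x => S.indicator (fun x => √(gibbs μ H f c β x)) x)
  convert h using 1
  · refine Finset.sum_congr rfl fun x _ => ?_
    by_cases hx : x ∈ S
    · simp only [Set.indicator_of_mem hx]
      rw [div_mul_cancel₀ _ (Real.sqrt_pos.2 (hπ x)).ne']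
    · simp [Set.indicator_of_notMem hx]
  · congr 2
    · refine Finset.sum_congr rfl fun x _ => ?_
      rw [div_pow, Real.sq_sqrt (hπ x).le, div_eq_mul_inv]
    · refine Finset.sum_congr rfl fun x _ => ?_
      by_cases hx : x ∈ S
      · simp only [Set.indicator_of_mem hx]
        rw [Real.sq_sqrt (hπ x).le]
      · simp [Set.indicator_of_notMem hx]

end Energy

/-! ### A Bernoulli differential inequality -/

/-- The substitution `w = N^(-e)` linearises the inequality: `w' ≥ e κ (θ - w)/(1+t)`, with
equilibrium `θ = 1/(4Aκ)`. So `(w - θ)(1+t)^(κe)` is non-decreasing; as `w 0 > 0`, it stays above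
`-θ` whatever `N 0` is. -/
theorem rpow_le_of_bernoulli {N : ℝ → ℝ} {A κ e : ℝ} (hA : 0 < A) (hκ : 0 < κ) (he : 0 < e)
    (hcont : ContinuousOn N (Set.Ici 0)) (h1 : ∀ t, 0 ≤ t → 1 ≤ N t)
    (hder : ∀ t, 0 < t → ∃ N', HasDerivAt N N' t ∧
      N' ≤ (κ * N t - N t ^ (1 + e) / (4 * A)) / (1 + t))
    {t : ℝ} (ht : Real.exp (1 / e) - 1 ≤ t) :
    N t ^ e ≤ 4 * A * κ / (1 - Real.exp (-κ)) := by
  have ht1 : Real.exp (1 / e) ≤ 1 + t := by linarith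
  have ht0 : 0 ≤ t := by linarith [Real.one_le_exp (one_div_nonneg.2 he.le)]
  set θ := 1 / (4 * A * κ) with hθ
  have hθ0 : 0 < θ := by positivity
  set g : ℝ → ℝ := fun s => (N s ^ (-e) - θ) * (1 + s) ^ (κ * e) with hg
  have hmono : MonotoneOn g (Set.Ici 0) := by
    have hgd : ∀ s, 0 < s → ∃ g', HasDerivAt g g' s ∧ 0 ≤ g' := by
      intro s hs
      obtain ⟨N', hN, hN'⟩ := hder s hs
      have hNs : 0 < N s := zero_lt_one.trans_le (h1 s hs.le)
      have hs1 : 0 < 1 + s := by linarith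
      have hw : HasDerivAt (fun s => N s ^ (-e) - θ) (N' * -e * N s ^ (-e - 1)) s :=
        (hN.rpow_const (Or.inl hNs.ne')).sub_const θ
      have hp : HasDerivAt (fun s : ℝ => (1 + s) ^ (κ * e))
          (1 * (κ * e) * (1 + s) ^ (κ * e - 1)) s :=
        ((hasDerivAt_id s).const_add 1).rpow_const (Or.inl hs1.ne')
      refine ⟨_, hw.mul hp, ?_⟩
      have e1 : N s ^ (-e - 1) = N s ^ (-e) / N s := Real.rpow_sub_one hNs.ne' _
      have e2 : (1 + s) ^ (κ * e - 1) = (1 + s) ^ (κ * e) / (1 + s) :=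
        Real.rpow_sub_one hs1.ne' _
      have e3 : N s ^ (1 + e) * N s ^ (-e) = N s := by
        rw [← Real.rpow_add hNs]; simp
      have hwpos : 0 < N s ^ (-e) := Real.rpow_pos_of_pos hNs _
      have hppos : 0 < (1 + s) ^ (κ * e) := Real.rpow_pos_of_pos hs1 _
      have h2 : N' * N s ^ (-e) ≤ (κ * N s * N s ^ (-e) - N s / (4 * A)) / (1 + s) := by
        calc _ ≤ (κ * N s - N s ^ (1 + e) / (4 * A)) / (1 + s) * N s ^ (-e) :=
              mul_le_mul_of_nonneg_right hN' hwpos.le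
          _ = (κ * N s * N s ^ (-e) - (N s ^ (1 + e) * N s ^ (-e)) / (4 * A)) / (1 + s) := by
              ring
          _ = _ := by rw [e3]
      have h3 : N' * N s ^ (-e) / N s ≤ κ * (N s ^ (-e) - θ) / (1 + s) := by
        rw [div_le_iff₀ hNs]
        refine h2.trans (le_of_eq ?_)
        rw [hθ]
        field_simp
      rw [e1, e2]
      have h4 : N' * -e * (N s ^ (-e) / N s) * (1 + s) ^ (κ * e) +
          (N s ^ (-e) - θ) * (1 * (κ * e) * ((1 + s) ^ (κ * e) / (1 + s))) =
          e * (1 + s) ^ (κ * e) *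
            (κ * (N s ^ (-e) - θ) / (1 + s) - N' * N s ^ (-e) / N s) := by ring
      rw [h4]
      exact mul_nonneg (by positivity) (sub_nonneg.2 h3)
    refine monotoneOn_of_deriv_nonneg (convex_Ici 0) ?_ ?_ ?_
    · refine ((hcont.rpow_const fun s hs => Or.inl ?_).sub continuousOn_const).mul
        (ContinuousOn.rpow_const (by fun_prop) fun s hs => Or.inl ?_)
      · exact (zero_lt_one.trans_le (h1 s hs)).ne'
      · have : (0 : ℝ) ≤ s := hs
        positivity
    · intro s hs
      rw [interior_Ici] at hs
      obtain ⟨g', h, -⟩ := hgd s hs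
      exact h.differentiableAt.differentiableWithinAt
    · intro s hs
      rw [interior_Ici] at hs
      obtain ⟨g', h, h'⟩ := hgd s hs
      rwa [h.deriv]
  have h0 : g 0 ≤ g t := hmono Set.self_mem_Ici ht0 ht0
  have hN : 0 < N t := zero_lt_one.trans_le (h1 t ht0)
  have hw0 : 0 < N 0 ^ (-e) := Real.rpow_pos_of_pos (zero_lt_one.trans_le (h1 0 le_rfl)) _
  -- The time threshold is exactly what makes the integrating factor at least `e^κ`.
  have hP : Real.exp κ ≤ (1 + t) ^ (κ * e) := by
    calc Real.exp κ = Real.exp (1 / e) ^ (κ * e) := by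
          rw [← Real.exp_mul]; congr 1; field_simp
      _ ≤ _ := Real.rpow_le_rpow (Real.exp_pos _).le ht1 (by positivity)
  have hexp : Real.exp (-κ) < 1 := Real.exp_lt_one_iff.2 (by linarith)
  have hwt : θ * (1 - Real.exp (-κ)) ≤ N t ^ (-e) := by
    simp only [hg, add_zero, Real.one_rpow, mul_one] at h0
    by_contra! hlt
    have h5 : N t ^ (-e) - θ < -(θ * Real.exp (-κ)) := by linarith
    have h6 : (N t ^ (-e) - θ) * (1 + t) ^ (κ * e) < -(θ * Real.exp (-κ)) * Real.exp κ := by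
      have hk := Real.exp_pos κ
      have : 0 < θ * Real.exp (-κ) := by positivity
      nlinarith
    have h7 : -(θ * Real.exp (-κ)) * Real.exp κ = -θ := by
      rw [neg_mul, mul_assoc, ← Real.exp_add]; simp
    linarith
  rw [Real.rpow_neg hN.le] at hwt
  have hNe : 0 < N t ^ e := Real.rpow_pos_of_pos hN e
  rw [le_div_iff₀ (by linarith)]
  have h8 := mul_le_mul_of_nonneg_left hwt (show 0 ≤ N t ^ e * (4 * A * κ) by positivity)
  have h9 : N t ^ e * (4 * A * κ) * (N t ^ e)⁻¹ = 4 * A * κ := by field_simp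
  have h10 : N t ^ e * (4 * A * κ) * (θ * (1 - Real.exp (-κ))) =
      N t ^ e * (1 - Real.exp (-κ)) := by rw [hθ]; field_simp
  linarith

/-! ### Evolution of the density along the schedule -/

theorem hasDerivAt_invTemp (Q : Matrix X X ℝ) (H : X → ℝ) (c ε : ℝ) {t : ℝ} (ht : 0 < t) :
    HasDerivAt (fun t => invTemp Q H c ε t) (1 / (t + 1) / (clippedHeight Q H c + ε)) t :=
  (((hasDerivAt_id t).add_const 1).log (by simp; linarith)).div_const _

theorem continuousOn_invTemp (Q : Matrix X X ℝ) (H : X → ℝ) (c ε : ℝ) :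
    ContinuousOn (fun t => invTemp Q H c ε t) (Set.Ici 0) :=
  (ContinuousOn.log (by fun_prop) fun t ht => by
    have : (0 : ℝ) ≤ t := ht
    positivity).div_const _

section Evolution

variable [Fintype X] {Q : Matrix X X ℝ} {μ H : X → ℝ} {f : ℝ → ℝ} {c ε C₂ : ℝ}

/-- `ρ` solves the Kolmogorov forward equation along the schedule, through probability vectors. -/
structure IsForwardSolution (Q : Matrix X X ℝ) (H : X → ℝ) (f : ℝ → ℝ) (c ε : ℝ)
    (ρ : ℝ → X → ℝ) : Prop where
  nonneg : ∀ t, 0 ≤ t → ∀ x, 0 ≤ ρ t x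
  sum_eq_one : ∀ t, 0 ≤ t → ∑ x, ρ t x = 1
  hasDeriv : ∀ t, 0 ≤ t → ∀ x, HasDerivWithinAt (fun r => ρ r x)
    (∑ y, ρ t y * gen Q H f c (invTemp Q H c ε t) y x) (Set.Ici 0) t

variable {ρ : ℝ → X → ℝ}

theorem continuousOn_densitySq [Nonempty X] (hQ : IsProposal Q μ) (hf : IsModFun f)
    (hD : 0 < clippedHeight Q H c + ε) (hρ : IsForwardSolution Q H f c ε ρ) :
    ContinuousOn (fun t => densitySq (gibbs μ H f c (invTemp Q H c ε t)) (ρ t)) (Set.Ici 0) := by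
  refine continuousOn_finsetSum _ fun x _ => ContinuousOn.mul
    (ContinuousOn.pow (fun t ht => (hρ.hasDeriv t ht x).continuousWithinAt) 2) ?_
  exact ((continuousOn_gibbs hQ hf x).comp (continuousOn_invTemp Q H c ε)
    fun t ht => invTemp_nonneg hD ht).inv₀ fun t _ => (gibbs_pos hQ x).ne'

/-- Product rule: the moving weight `1/π_t` gives the growth term, through `β_t' = 1/((1+t)(c*+ε))`;
the moving law gives the gap term. -/
theorem hasDerivAt_densitySq [Nonempty X] (hQ : IsProposal Q μ) (hf : IsModFun f)
    (hD : 0 < clippedHeight Q H c + ε) (hρ : IsForwardSolution Q H f c ε ρ) {t : ℝ} (ht : 0 < t) :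
    ∃ N', HasDerivAt (fun t => densitySq (gibbs μ H f c (invTemp Q H c ε t)) (ρ t)) N' t ∧
      N' ≤ osc H / (clippedHeight Q H c + ε) / (1 + t) *
          densitySq (gibbs μ H f c (invTemp Q H c ε t)) (ρ t) -
        2 * (spectralGap (gibbs μ H f c (invTemp Q H c ε t)) (gen Q H f c (invTemp Q H c ε t)) *
          (densitySq (gibbs μ H f c (invTemp Q H c ε t)) (ρ t) - 1)) := by
  choose G' hG hG' using fun x =>
    hasDerivAt_gibbs_inv (H := H) (c := c) hQ hf (invTemp_pos hD ht) x
  have hρ' : ∀ x, HasDerivAt (fun r => ρ r x)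
      (∑ y, ρ t y * gen Q H f c (invTemp Q H c ε t) y x) t := fun x =>
    (hρ.hasDeriv t ht.le x).hasDerivAt (Ici_mem_nhds ht)
  have hinv := hasDerivAt_invTemp Q H c ε ht
  refine ⟨_, HasDerivAt.fun_sum fun x _ => ((hρ' x).pow 2).mul ((hG x).comp t hinv), ?_⟩
  have hb : 0 ≤ 1 / (t + 1) / (clippedHeight Q H c + ε) := by positivity
  have h1 := spectralGap_mul_densitySq_le (H := H) (f := f) (c := c)
    (β := invTemp Q H c ε t) hQ (hρ.sum_eq_one t ht.le)
  have h2 : ∑ x, ρ t x ^ 2 * (G' x * (1 / (t + 1) / (clippedHeight Q H c + ε))) ≤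
      osc H / (clippedHeight Q H c + ε) / (1 + t) *
          densitySq (gibbs μ H f c (invTemp Q H c ε t)) (ρ t) := by
    rw [densitySq, Finset.mul_sum]
    refine Finset.sum_le_sum fun x _ => ?_
    calc _ ≤ ρ t x ^ 2 * (osc H * (gibbs μ H f c (invTemp Q H c ε t) x)⁻¹ *
          (1 / (t + 1) / (clippedHeight Q H c + ε))) :=
          mul_le_mul_of_nonneg_left (mul_le_mul_of_nonneg_right (hG' x) hb) (sq_nonneg _)
      _ = _ := by rw [add_comm t 1]; ring
  have h3 : ∀ x, (2 : ℕ) * ρ t x ^ (2 - 1) *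
        (∑ y, ρ t y * gen Q H f c (invTemp Q H c ε t) y x) *
          (gibbs μ H f c (invTemp Q H c ε t) x)⁻¹ =
      2 * (ρ t x * (∑ y, ρ t y * gen Q H f c (invTemp Q H c ε t) y x) *
        (gibbs μ H f c (invTemp Q H c ε t) x)⁻¹) := by
    intro x
    norm_num
    ring
  simp only [Finset.sum_add_distrib, Pi.pow_apply, h3, ← Finset.mul_sum]
  linarith

theorem densitySq_le_constK [Nonempty X] (hQ : IsProposal Q μ) (hf : IsModFun f)
    (hc : minH H ≤ c) (hc' : c ≤ maxH H) (hC : IsGapConst Q μ H f c C₂)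
    (hε : maxH H - c < ε) (hε' : ε < osc H + maxH H - c) (hρ : IsForwardSolution Q H f c ε ρ)
    {t : ℝ} (ht : Real.exp (1 / epsBar H c ε) - 1 ≤ t) :
    densitySq (gibbs μ H f c (invTemp Q H c ε t)) (ρ t) ^ epsBar H c ε ≤
      constK (constA μ H f c ε C₂) (constB Q H c ε) := by
  have hD := clippedHeight_add_pos hQ hc hc' hε
  have hA := constA_pos hQ hf hC.1 hε hε'
  have he := epsBar_pos hε hε'
  have hM := osc_pos hε hε'
  have hB : 0 < constB Q H c ε := div_pos (by positivity) hD
  have h1 : ∀ s, 0 ≤ s → 1 ≤ densitySq (gibbs μ H f c (invTemp Q H c ε s)) (ρ s) :=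
    fun s hs => one_le_densitySq hQ (hρ.sum_eq_one s hs)
  set A := constA μ H f c ε C₂
  set B := constB Q H c ε with hBdef
  -- With this `κ`, `4Aκ = 2 + 4AB`, at most the numerator `4(1 + 2AB)` of `constK`.
  have key := rpow_le_of_bernoulli (κ := 1 / (2 * A) + B) hA (by positivity) he
    (continuousOn_densitySq hQ hf hD hρ) h1 (fun s hs => ?_) ht
  · refine key.trans ?_
    have e1 : -(1 / (2 * A) + B) = -(1 / (2 * A)) - B := by ring
    have hexp : Real.exp (-(1 / (2 * A)) - B) < 1 := by
      rw [← e1]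
      exact Real.exp_lt_one_iff.2 (neg_lt_zero.2 (by positivity))
    rw [constK, e1]
    refine div_le_div_of_nonneg_right ?_ (by linarith)
    have e2 : 4 * A * (1 / (2 * A) + B) = 2 + 4 * (A * B) := by field_simp; ring
    rw [e2]
    nlinarith [mul_pos hA hB]
  · obtain ⟨N', hN, hN'⟩ := hasDerivAt_densitySq hQ hf hD hρ hs
    refine ⟨N', hN, hN'.trans ?_⟩
    have hN1 := h1 s hs.le
    have hgap := densitySq_rpow_le hQ (hρ.nonneg s hs.le) (hρ.sum_eq_one s hs.le) he.le
      fun x => gibbs_rpow_le_gap hQ hf hc hc' hC hε hε' hs x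
    set N := densitySq (gibbs μ H f c (invTemp Q H c ε s)) (ρ s)
    set gap := spectralGap (gibbs μ H f c (invTemp Q H c ε s)) (gen Q H f c (invTemp Q H c ε s))
    have hN0 : 0 < N := by linarith
    set R := N ^ epsBar H c ε with hR
    have hR0 : 0 < R := Real.rpow_pos_of_pos hN0 _
    -- This needs `ε̄ ≤ 1`, and it gives `N R - N ≤ R (N - 1)`: the damping survives replacing `N -
    -- 1` by `N`, at a linear cost absorbed in `κ`.
    have hRN : R ≤ N := by
      calc R ≤ N ^ (1 : ℝ) := Real.rpow_le_rpow_of_exponent_le hN1 (epsBar_le_one hε hε')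
        _ = N := Real.rpow_one N
    have e1 : N ^ (1 + epsBar H c ε) = N * R := by
      rw [Real.rpow_add hN0, Real.rpow_one]
    have e2 : osc H / (clippedHeight Q H c + ε) = B / 6 := by
      rw [hBdef, constB]; field_simp
    have hs1 : 0 < 1 + s := by linarith
    have hgap' : R * (N - 1) ≤ A * (1 + s) * (gap * (N - 1)) := by
      rw [← mul_assoc]
      exact mul_le_mul_of_nonneg_right hgap (by linarith)
    rw [e1, e2, le_div_iff₀ hs1]
    have e3 : (B / 6 / (1 + s) * N - 2 * (gap * (N - 1))) * (1 + s) =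
        B / 6 * N - 2 * (A * (1 + s) * (gap * (N - 1))) / A := by field_simp
    have h4 : 2 * (R * (N - 1)) / A ≤ 2 * (A * (1 + s) * (gap * (N - 1))) / A := by gcongr
    have h5 : (N * R - N) / (4 * A) ≤ 2 * (R * (N - 1)) / A := by
      rw [div_le_div_iff₀ (by positivity) hA]
      have : N * R - N ≤ R * (N - 1) := by linarith
      nlinarith [mul_nonneg hR0.le (sub_nonneg.2 hN1)]
    have e4 : (N * R - N) / (4 * A) = N * R / (4 * A) - N / (2 * A) / 2 := by ring
    have e5 : (1 / (2 * A) + B) * N = N / (2 * A) + B * N := by ring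
    have h6 : 0 ≤ N / (2 * A) := by positivity
    have h7 : 0 ≤ B * N := by positivity
    rw [e3, e5]
    linarith

end Evolution

/-! ### The hitting time -/

theorem sum_measureReal_eq {Ω : Type*} [MeasurableSpace Ω] {P : Measure Ω}
    [IsFiniteMeasure P] {Y : Ω → X} (hY : ∀ y, MeasurableSet {ω | Y ω = y}) (S : Finset X) :
    ∑ z ∈ S, P.real {ω | Y ω = z} = P.real {ω | Y ω ∈ S} := by
  rw [← measureReal_biUnion_finset (fun a _ b _ hab => Set.disjoint_left.2
    fun ω h1 h2 => hab (h1.symm.trans h2)) fun z _ => hY z]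
  congr 1
  ext ω
  simp

/-- Being in `S` at time `t` forces the hitting time to be at most `t`, so one-time marginals
suffice. -/
theorem hitting_gt_subset {Ω : Type*} (Y : ℝ≥0 → Ω → X) (S : Set X) (t : ℝ≥0) :
    {ω | (t : WithTop ℝ≥0) < hittingAfter Y S 0 ω} ⊆ {ω | Y t ω ∉ S} := by
  intro ω hω hmem
  have h : hittingAfter Y S 0 ω ≤ t := by
    classical
    rw [hittingAfter_def]
    dsimp only
    rw [if_pos ⟨t, zero_le, hmem⟩, WithTop.coe_le_coe]
    exact csInf_le (OrderBot.bddBelow _) ⟨zero_le, hmem⟩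
  exact absurd hω (not_lt.2 h)

section Hitting

variable [Fintype X] {Q : Matrix X X ℝ} {μ H : X → ℝ} {f : ℝ → ℝ} {c ε C₂ : ℝ}
  {Ω : Type*} [MeasurableSpace Ω] {P : Measure Ω} [IsProbabilityMeasure P]

/-- The Markov property at time `0` with the trivial event, combined with the almost sure start. -/
theorem IsMarkovChain.exists_law {L : ℝ → Matrix X X ℝ} {x : X} {Y : ℝ≥0 → Ω → X}
    (hY : IsMarkovChain P L x Y) :
    ∃ T, IsTransitionFamily L T ∧ ∀ (t : ℝ≥0) z, P.real {ω | Y t ω = z} = T 0 t x z := by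
  obtain ⟨T, hT, hm⟩ := hY.markov
  refine ⟨T, hT, fun t z => ?_⟩
  have h := hm 0 t zero_le Set.univ (@MeasurableSet.univ _ (_)) x z
  have h0 : (Set.univ ∩ {ω | Y 0 ω = x} : Set Ω) =ᵐ[P] Set.univ := by
    rw [Set.univ_inter, ae_eq_univ]
    exact hY.start
  have h1 : (Set.univ ∩ {ω | Y 0 ω = x} ∩ {ω | Y t ω = z} : Set Ω) =ᵐ[P] {ω | Y t ω = z} := by
    have := h0.inter (ae_eq_refl {ω | Y t ω = z})
    rwa [Set.univ_inter {ω | Y t ω = z}] at this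
  rw [measureReal_congr h0, measureReal_congr h1] at h
  simpa using h

theorem hitting_bound [Nonempty X] (hQ : IsProposal Q μ) (hf : IsModFun f)
    (hc : minH H ≤ c) (hc' : c ≤ maxH H) (hC : IsGapConst Q μ H f c C₂)
    (hε : maxH H - c < ε) (hε' : ε < osc H + maxH H - c) {x : X} {Y : ℝ≥0 → Ω → X}
    (hY : IsMarkovChain P (fun t => gen Q H f c (invTemp Q H c ε t)) x Y)
    {t : ℝ≥0} (ht : Real.exp (1 / epsBar H c ε) - 1 ≤ (t : ℝ)) :
    P.real {ω | (t : WithTop ℝ≥0) < hittingAfter Y (argminSet H) 0 ω} ≤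
      hitBound Q μ H f c ε C₂ t := by
  classical
  obtain ⟨T, hT, hlaw⟩ := hY.exists_law
  -- `IsTransitionFamily` does not assert stochasticity; nonnegativity and total mass `1` are read
  -- off from the law of `Y`.
  have hρ : IsForwardSolution Q H f c ε fun t z => T 0 t x z := by
    refine ⟨fun s hs z => ?_, fun s hs => ?_, fun s hs z => ?_⟩
    · lift s to ℝ≥0 using hs
      exact hlaw s z ▸ measureReal_nonneg
    · lift s to ℝ≥0 using hs
      have h := sum_measureReal_eq (P := P) (hY.measurable s) Finset.univ
      simp only [hlaw, Finset.mem_univ, Set.ofPred_true] at h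
      simpa using h
    · exact (hT 0 le_rfl).2.2 s hs x z
  have hK := densitySq_le_constK hQ hf hc hc' hC hε hε' hρ ht
  have he := epsBar_pos hε hε'
  have ht0 : (0 : ℝ) ≤ t := t.2
  have hN1 := one_le_densitySq (H := H) (f := f) (c := c) (β := invTemp Q H c ε t) hQ
    (hρ.sum_eq_one t ht0)
  have hCS := sum_indicator_le (H := H) (f := f) (c := c) (β := invTemp Q H c ε t) hQ
    (fun z => T 0 t x z) (argminSet H)ᶜ
  have hP : P.real {ω | Y t ω ∉ argminSet H} = mass (fun z => T 0 t x z) (argminSet H)ᶜ := by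
    have h := sum_measureReal_eq (P := P) (hY.measurable t)
      (Finset.univ.filter fun z => z ∉ argminSet H)
    simp only [Finset.mem_filter, Finset.mem_univ, true_and] at h
    rw [← h, mass, Finset.sum_filter]
    refine Finset.sum_congr rfl fun z _ => ?_
    rw [Set.indicator_apply, hlaw]
    rfl
  set N := densitySq (gibbs μ H f c (invTemp Q H c ε t)) (fun z => T 0 t x z)
  have hsqrt : √N ≤ constK (constA μ H f c ε C₂) (constB Q H c ε) ^ (1 / (2 * epsBar H c ε)) := by
    calc √N = (N ^ epsBar H c ε) ^ (1 / (2 * epsBar H c ε)) := by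
          rw [← Real.rpow_mul (by linarith), Real.sqrt_eq_rpow]
          congr 1
          field_simp
      _ ≤ _ := Real.rpow_le_rpow (Real.rpow_nonneg (by linarith) _) hK (by positivity)
  have hoff : 0 ≤ offMin Q μ H f c ε t := offMin_nonneg hQ t
  calc _ ≤ P.real {ω | Y t ω ∉ argminSet H} := measureReal_mono (hitting_gt_subset Y _ t)
    _ ≤ √N * √(offMin Q μ H f c ε t) := hP ▸ hCS
    _ ≤ (1 + constK (constA μ H f c ε C₂) (constB Q H c ε) ^ (1 / (2 * epsBar H c ε))) *
        √(offMin Q μ H f c ε t) := by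
        gcongr
        linarith
    -- `√N √π_t(X ∖ S_min)` already bounds the probability; the `1 +` and the last summand are
    -- slack.
    _ ≤ _ := le_add_of_nonneg_right hoff

end Hitting

end LandSA

/-! ### The main theorem. -/

theorem mainTheorem5 {X : Type*} [Fintype X] [Nontrivial X]
    (Q : Matrix X X ℝ) (μ : X → ℝ) (hQ : IsProposal Q μ) :
    (∃ C₂ : ℝ, ∀ (H : X → ℝ) (f : ℝ → ℝ) (c : ℝ),
      IsModFun f → minH H ≤ c → c ≤ maxH H → IsGapConst Q μ H f c C₂) ∧
    ∀ (H : X → ℝ) (f : ℝ → ℝ) (c : ℝ),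
      IsModFun f → minH H ≤ c → c ≤ maxH H →
      ∀ C₂ : ℝ, IsGapConst Q μ H f c C₂ →
      ∀ ε : ℝ, maxH H - c < ε → ε < osc H + maxH H - c →
        (∀ (Ω : Type*) [MeasurableSpace Ω] (P : Measure Ω) [IsProbabilityMeasure P]
            (x : X) (Y : ℝ≥0 → Ω → X),
          x ∉ argminSet H →
          IsMarkovChain P (fun t => gen Q H f c (invTemp Q H c ε t)) x Y →
          ∀ t : ℝ≥0, Real.exp (1 / epsBar H c ε) - 1 ≤ (t : ℝ) →
            P.real {ω | (t : WithTop ℝ≥0) < hittingAfter Y (argminSet H) 0 ω} ≤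
              hitBound Q μ H f c ε C₂ t) ∧
        Tendsto (fun t : ℝ => hitBound Q μ H f c ε C₂ t) atTop (𝓝 0) ∧
        (secondMin H ≤ c → ∀ t : ℝ, 0 < t →
          offMin Q μ H f c ε t ≤
            1 / mass μ (argminSet H) *
              Real.exp (-(invTemp Q H c ε t * (secondMin H - minH H)))) ∧
        (c < secondMin H → ∀ t : ℝ, 0 < t →
          offMin Q μ H f c ε t ≤
            1 / mass μ (argminSet H) *
              Real.exp (-∫ u in c..(secondMin H), 1 / (f (u - c) + temp Q H c ε t))) := by
  obtain ⟨C₂, hC₂⟩ := exists_isGapConst hQ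
  refine ⟨⟨C₂, fun H f c _ _ _ => hC₂ H f c⟩, ?_⟩
  intro H f c hf hc hc' C₂ hC ε hε hε'
  have hD := clippedHeight_add_pos hQ hc hc' hε
  refine ⟨?_, tendsto_hitBound hQ hf hc hc' hε hε', ?_, ?_⟩
  · intro Ω _ P _ x Y _ hY t ht
    exact hitting_bound hQ hf hc hc' hC hε hε' hY ht
  · exact fun hd t ht =>
      offMin_le_of_secondMin_le hQ hf (osc_pos hε hε') hd (invTemp_nonneg hD ht.le)
  · exact fun hd t ht => offMin_le_of_lt_secondMin hQ hf hc hd (temp_pos hD ht)
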